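/- Let $q$ be an odd prime power, let $\mathbb{K}$ be an algebraic closure of $\mathbb{F}_{q^4}$, let $\beta\in\mathbb{F}_{q^4}\setminus\{0,1,-1\}$ and let $\eta$ be a non-square in $\mathbb{F}_{q^4}$. Let $\mathcal{V}\subset\mathbb{P}^7(\mathbb{K})$ be the projective variety, in homogeneous coordinates $(W_0:W_1:W_2:X_3:Y_0:Y_1:Y_2:Y_3)$, with equations \[ \begin{cases} W_0^2 = \eta Y_0^2 + \eta^{q} Y_1^2 - 2\beta\eta^{\frac{q+1}{2}}Y_0 Y_1,\\ W_1^2 = \eta^q Y_1^2 + \eta^{q^2} Y_2^2 - 2\beta^q\eta^{\frac{q^2+q}{2}}Y_1 Y_2,\\ W_2^2 = \eta^{q^2} Y_2^2 + \eta^{q^3} Y_3^2 - 2\beta^{q^2}\eta^{\frac{q^3+q^2}{2}}Y_2 Y_3,\\ (W_0+W_1+W_2)^2 = \eta^{q^3} Y_3^2 + \eta Y_0^2 - 2\beta^{q^3}\eta^{\frac{1+q^3}{2}}Y_3 Y_0. \end{cases} \] Then $\mathcal{V}$ has dimension $3$ and degree $16$. Moreover, there is a $3$-dimensional linear subspace of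 $\mathbb{P}^7$ disjoint from $\mathcal{V}$, and the homogeneous ideal of $\mathcal{V}$ is generated by the four quadratic forms above (left-hand side minus right-hand side), so that $\mathcal{V}$ is a complete intersection of four quadrics. Here the dimension is the Krull dimension of $\mathcal{V}$ in the Zariski topology, and the degree is $r!$ times the leading coefficient of the Hilbert polynomial (of degree $r$) of the homogeneous coordinate ring $\mathbb{K}[W_0,\dots,Y_3]/I(\mathcal{V})$, where $I(\mathcal{V})$ is the ideal generated by all homogeneous polynomials vanishing on $\mathcal{V}$. -/

import Mathlib

open MvPolynomial
open scoped LinearAlgebra.Projectivization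

/-- The projective space of dimension `N` over `K`, as its set of `K`-points. -/
abbrev ProjSpace (K : Type*) [Field K] (N : ℕ) : Type _ := ℙ K (Fin (N + 1) → K)

/-- The common zeros in projective space of a set of homogeneous polynomials.
For homogeneous `f` the condition `f(P) = 0` does not depend on the representative vector,
see `eval_rep_eq_zero_iff`. -/
def projZeroLocus {K : Type*} [Field K] {N : ℕ} (S : Set (MvPolynomial (Fin (N + 1)) K)) :
    Set (ProjSpace K N) :=
  {P | ∀ f ∈ S, eval P.rep f = 0}

theorem eval_rep_eq_zero_iff {K : Type*} [Field K] {N : ℕ} {f : MvPolynomial (Fin (N + 1)) K}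
    {d : ℕ} (hf : f.IsHomogeneous d) (v : Fin (N + 1) → K) (hv : v ≠ 0) :
    eval (Projectivization.mk K v hv).rep f = 0 ↔ eval v f = 0 := by
  obtain ⟨a, ha⟩ := Projectivization.exists_smul_eq_mk_rep K v hv
  have h : eval (Projectivization.mk K v hv).rep f = (a : K) ^ d * eval v f := by
    rw [← ha]
    rw [eval_eq, eval_eq, Finset.mul_sum]
    refine Finset.sum_congr rfl fun m hm => ?_
    have hd : ∑ i, m i = d := by
      have := hf (mem_support_iff.mp hm)
      rw [Finsupp.weight_apply, Finsupp.sum_fintype _ _ (by simp)] at this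
      simpa using this
    have : ∀ i, ((a • v) i) = (a : K) * v i := fun i => rfl
    simp only [this]
    rw [Finset.prod_subset (Finset.subset_univ m.support) (by intro i _ hi; simp_all),
      Finset.prod_subset (Finset.subset_univ m.support) (by intro i _ hi; simp_all),
      ← hd, ← Finset.prod_pow_eq_pow_sum]
    simp only [mul_pow, Finset.prod_mul_distrib]
    ring
  rw [h]
  simp

/-- The Zariski topology of projective space: the closed sets are the common zero loci of
sets of homogeneous polynomials. -/
@[reducible] def zariskiTopology (K : Type*) [Field K] (N : ℕ) : TopologicalSpace (ProjSpace K N) :=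
  TopologicalSpace.ofClosed
    {Z | ∃ S : Set (MvPolynomial (Fin (N + 1)) K),
      (∀ f ∈ S, ∃ d : ℕ, f.IsHomogeneous d) ∧ Z = projZeroLocus S}
    ⟨{1}, by
      rintro f rfl
      exact ⟨0, isHomogeneous_one _ _⟩, by
      ext P
      simp [projZeroLocus]⟩
    (by
      intro A hA
      refine ⟨{f | (∃ d : ℕ, f.IsHomogeneous d) ∧ ∃ Z ∈ A, ∀ P ∈ Z, eval P.rep f = 0},
        fun f hf => hf.1, ?_⟩
      ext P
      constructor
      · rintro hP f ⟨-, Z, hZ, hf⟩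
        exact hf P (hP Z hZ)
      · intro hP Z hZ
        obtain ⟨S, hS, rfl⟩ := hA hZ
        exact fun f hf => hP f ⟨hS f hf, _, hZ, fun Q hQ => hQ f hf⟩)
    (by
      rintro _ ⟨S, hS, rfl⟩ _ ⟨T, hT, rfl⟩
      refine ⟨{h | ∃ f ∈ S, ∃ g ∈ T, h = f * g}, ?_, ?_⟩
      · rintro _ ⟨f, hf, g, hg, rfl⟩
        obtain ⟨d, hd⟩ := hS f hf
        obtain ⟨e, he⟩ := hT g hg
        exact ⟨d + e, hd.mul he⟩
      · ext P
        constructor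
        · rintro (hP | hP) _ ⟨f, hf, g, hg, rfl⟩
          · simp [hP f hf]
          · simp [hP g hg]
        · intro hP
          by_contra hcon
          simp only [Set.mem_union, projZeroLocus, Set.mem_ofPred_eq, not_or, not_forall] at hcon
          obtain ⟨⟨f, hf, hf0⟩, ⟨g, hg, hg0⟩⟩ := hcon
          have := hP (f * g) ⟨f, hf, g, hg, rfl⟩
          rw [map_mul] at this
          exact (mul_ne_zero hf0 hg0) this)

/-- The dimension of a subset of projective space: its Krull dimension as a topological space
(the supremum of the lengths of chains of irreducible closed subsets), for the topology induced
by the Zariski topology. -/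
noncomputable def projDim {K : Type*} [Field K] {N : ℕ} (V : Set (ProjSpace K N)) :
    WithBot ℕ∞ :=
  letI := zariskiTopology K N
  topologicalKrullDim V

/-- The homogeneous ideal of a subset of projective space: the ideal generated by all the
homogeneous polynomials that vanish on it. -/
noncomputable def projVanishingIdeal {K : Type*} [Field K] {N : ℕ} (V : Set (ProjSpace K N)) :
    Ideal (MvPolynomial (Fin (N + 1)) K) :=
  Ideal.span {f | (∃ d : ℕ, f.IsHomogeneous d) ∧ ∀ P ∈ V, eval P.rep f = 0}

/-- The Hilbert function of `V`: the dimension over `K` of the degree `t` part of the homogeneous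
coordinate ring of `V`. -/
noncomputable def hilbertFun {K : Type*} [Field K] {N : ℕ} (V : Set (ProjSpace K N)) (t : ℕ) :
    ℕ :=
  Module.finrank K
    (homogeneousSubmodule (Fin (N + 1)) K t ⧸
      ((projVanishingIdeal V).restrictScalars K).submoduleOf
        (homogeneousSubmodule (Fin (N + 1)) K t))

/-- `V` has degree `d`: the Hilbert function of `V` agrees for all large arguments with a
polynomial (the Hilbert polynomial of `V`) whose leading coefficient is `d / r!`, where `r`
is the degree of that polynomial. -/
def HasProjDegree {K : Type*} [Field K] {N : ℕ} (V : Set (ProjSpace K N)) (d : ℕ) : Prop :=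
  ∃ H : Polynomial ℚ, (∀ᶠ t : ℕ in Filter.atTop, (hilbertFun V t : ℚ) = H.eval (t : ℚ)) ∧
    (H.natDegree.factorial : ℚ) * H.leadingCoeff = d

/-- The four quadratic forms (right-hand side subtracted from the left-hand side).
The coordinates `(W₀ : W₁ : W₂ : X₃ : Y₀ : Y₁ : Y₂ : Y₃)` of the projective space of dimension 7
are `X 0, …, X 7` in this order. For odd `q` the exponents below are integers. -/
noncomputable def quadricForm {K : Type*} [Field K] (q : ℕ) (β η : K) :
    Fin 4 → MvPolynomial (Fin (7 + 1)) K :=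
  ![X 0 ^ 2 - (C η * X 4 ^ 2 + C (η ^ q) * X 5 ^ 2
      - C (2 * β * η ^ ((q + 1) / 2)) * X 4 * X 5),
    X 1 ^ 2 - (C (η ^ q) * X 5 ^ 2 + C (η ^ q ^ 2) * X 6 ^ 2
      - C (2 * β ^ q * η ^ ((q ^ 2 + q) / 2)) * X 5 * X 6),
    X 2 ^ 2 - (C (η ^ q ^ 2) * X 6 ^ 2 + C (η ^ q ^ 3) * X 7 ^ 2
      - C (2 * β ^ q ^ 2 * η ^ ((q ^ 3 + q ^ 2) / 2)) * X 6 * X 7),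
    (X 0 + X 1 + X 2) ^ 2 - (C (η ^ q ^ 3) * X 7 ^ 2 + C η * X 4 ^ 2
      - C (2 * β ^ q ^ 3 * η ^ ((1 + q ^ 3) / 2)) * X 7 * X 4)]

/-- The projective variety in the projective space of dimension 7 defined by the four
quadratic equations. -/
def varietyV {K : Type*} [Field K] (q : ℕ) (β η : K) : Set (ProjSpace K 7) :=
  projZeroLocus (Set.range (quadricForm q β η))

/-! Choose `s` in `K` with `s ^ 2 = η` and put `y_i = s ^ q ^ i * Y_i`, `b_i = β ^ q ^ i`. The
equations become `W_i² = y_i² + y_{i+1}² - 2 b_i y_i y_{i+1}` for `i = 0, 1, 2`, and the last one,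
between `y_3` and `y_0`, has `W_0 + W_1 + W_2` on the left. Let `I` be the ideal of the four forms
and `A` the quotient ring.

For a parameter `l ≠ 0` take the four linear forms `X_3, y_1, y_2, y_3 - l y_0` as parameters and
let `P` be the polynomial ring in them. The core of the proof is that `A` is free over `P`, with the
16 squarefree monomials in `W_0, W_1, W_2, y_0` as basis. They span because the fourth equation
minus the other three expresses `y_0²` through the products `W_i W_j` and terms of lower order in
these four variables, and the resulting rewriting can be solved when `b_3 ≠ 0` and `b_3² ≠ 1`
(`exists_stable_submodule_of_quadratic_relations`). They are independent because a degree-preserving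
surjection between finite-dimensional spaces is injective
(`eq_zero_of_mem_restrictSupport_of_mem_span`).

The Hilbert series of `A` is therefore `((1 + t) / (1 - t)) ^ 4`, which gives degree 16, and
integrality over `P` gives projective dimension `4 - 1 = 3`. The ring `A` is reduced as soon as one
fibre of the projection has 16 distinct points, for then the discriminant of the trace form is
nonzero (`isReduced_of_injective_fiber`). Such a fibre exists for suitable `l` (`exists_fibre`): one
construction works if `b_3² ≠ b_0²`, another if `b_2 = b_0`, and over the field with `q ^ 4`
elements the failure of the former condition forces the latter. So `I` is radical, and the
projective Nullstellensatz identifies it with the homogeneous ideal of the variety. The disjoint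
linear subspace is explicit: `X_3 = Y_2 = Y_3 = 0` and `y_0 = y_1`. -/

/-! ### Reducedness from one fibre, via the trace form. -/

/-- An algebra that is free of finite rank over a domain is reduced as soon as some fibre has as
many distinct points as the rank. -/
theorem isReduced_of_injective_fiber {P A K κ : Type*} [CommRing P] [IsDomain P] [CommRing A]
    [Algebra P A] [Field K] [Fintype κ] [DecidableEq κ] (b : Module.Basis κ P A) (ev : P →+* K)
    (χ : κ → A →+* K) (hχ : Function.Injective χ)
    (h : ∀ i p, χ i (algebraMap P A p) = ev p) : IsReduced A := by
  have : Module.Free P A := .of_basis b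
  have : Module.Finite P A := .of_basis b
  let E : Matrix κ κ K := Matrix.of fun k e => χ k (b e)
  -- All `χ k` restrict to `ev` on `P`, so a relation between the rows of `E`, which are values on a
  -- `P`-basis, is a relation between the characters on the whole of `A`. Dedekind's independence of
  -- characters excludes it.
  have hE : IsUnit E := by
    rw [← Matrix.linearIndependent_rows_iff_isUnit, Fintype.linearIndependent_iff]
    intro c hc
    have hli := (linearIndependent_monoidHom A K).comp (fun k => ((χ k : A →+* K) : A →* K))
      (fun i j hij => hχ (RingHom.ext fun a => DFunLike.congr_fun hij a))
    rw [Fintype.linearIndependent_iff] at hli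
    refine hli c (funext fun a => ?_)
    simp only [Finset.sum_apply, Pi.smul_apply, Function.comp_apply, smul_eq_mul, Pi.zero_apply]
    change ∑ k, c k * χ k a = 0
    rw [← b.sum_repr a]
    simp only [map_sum, Algebra.smul_def, map_mul, h, Finset.mul_sum]
    rw [Finset.sum_comm]
    refine Finset.sum_eq_zero fun e _ => ?_
    have := congrFun hc e
    simp only [Finset.sum_apply, Pi.smul_apply, smul_eq_mul, Pi.zero_apply, Matrix.row, E,
      Matrix.of_apply] at this
    calc _ = ev (b.repr a e) * ∑ k, c k * χ k (b e) := by
          rw [Finset.mul_sum]; exact Finset.sum_congr rfl fun k _ => by ring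
      _ = 0 := by rw [this, mul_zero]
  have hdet : IsUnit E.det := (Matrix.isUnit_iff_isUnit_det E).mp hE
  have htr : ∀ a, ev (Algebra.trace P A a) = ∑ k, χ k a := by
    intro a
    rw [Algebra.trace_eq_matrix_trace b, AddMonoidHom.map_trace]
    set M := (Algebra.leftMulMatrix b a).map ev
    -- Specialised along `ev`, multiplication by `a` is diagonalised by `E` with eigenvalues `χ k
    -- a`; hence its trace is their sum.
    have hM : Matrix.diagonal (fun k => χ k a) * E = E * M := by
      ext k j
      have h1 : χ k (a * b j) = ∑ i, χ k (b i) * M i j := by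
        conv_lhs => rw [← b.sum_repr (a * b j)]
        simp only [map_sum, Algebra.smul_def, map_mul, h, M, Matrix.map_apply,
          Algebra.leftMulMatrix_eq_repr_mul]
        exact Finset.sum_congr rfl fun i _ => mul_comm _ _
      rw [Matrix.diagonal_mul]
      simp only [Matrix.mul_apply, E, Matrix.of_apply]
      rw [← h1, map_mul]
    have : M = E⁻¹ * (Matrix.diagonal (fun k => χ k a) * E) := by
      rw [hM, ← Matrix.mul_assoc, Matrix.nonsing_inv_mul _ hdet, Matrix.one_mul]
    change Matrix.trace M = _
    rw [this, Matrix.trace_mul_comm, Matrix.mul_assoc, Matrix.mul_nonsing_inv _ hdet,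
      Matrix.mul_one, Matrix.trace_diagonal]
  -- The trace matrix specialises to `Eᵀ * E`, whose determinant is a nonzero square.
  have hT : (Algebra.traceMatrix P b).det ≠ 0 := by
    intro h0
    have h1 : (Algebra.traceMatrix P b).map ev = E.transpose * E := by
      ext i j
      simp only [Matrix.map_apply, Algebra.traceMatrix_apply, Algebra.traceForm_apply, htr,
        Matrix.mul_apply, Matrix.transpose_apply, E, Matrix.of_apply, map_mul]
    have h2 := congrArg ev h0
    rw [RingHom.map_det, map_zero, RingHom.mapMatrix_apply, h1, Matrix.det_mul,
      Matrix.det_transpose] at h2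
    exact hdet.ne_zero (mul_self_eq_zero.mp h2)
  refine ⟨fun f hf => ?_⟩
  -- For nilpotent `f` every trace of `f * b i` is nilpotent in the domain `P`, hence zero, so the
  -- coordinates of `f` lie in the kernel of the trace matrix.
  have hz : Matrix.mulVec (Algebra.traceMatrix P b) (b.equivFun f) = 0 := by
    rw [Algebra.traceMatrix_of_basis_mulVec]
    funext i
    have hn : IsNilpotent (f * b i) := (Commute.all _ _).isNilpotent_mul_right hf
    rw [Algebra.trace_apply]
    exact (LinearMap.isNilpotent_trace_of_isNilpotent (hn.map (Algebra.lmul P A))).eq_zero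
  exact b.equivFun.map_eq_zero_iff.mp (Matrix.eq_zero_of_mulVec_eq_zero hT hz)

/-! ### Independence of squarefree monomials modulo quadratic forms. -/

/-- A surjective degree-preserving linear endomorphism of a polynomial ring in finitely many
variables is injective. -/
theorem injective_of_surjective_of_isHomogeneous {σ K : Type*} [Finite σ] [Field K]
    (g : (σ →₀ ℕ) → MvPolynomial σ K) (hg : ∀ m, (g m).IsHomogeneous m.degree)
    (hs : Function.Surjective ((basisMonomials σ K).constr K g)) :
    Function.Injective ((basisMonomials σ K).constr K g) := by
  set Ψ := (basisMonomials σ K).constr K g with hΨ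
  have hm : ∀ m, Ψ (monomial m 1) = g m := fun m => by
    have := (basisMonomials σ K).constr_basis K g m
    rwa [coe_basisMonomials] at this
  have hc : ∀ t, homogeneousComponent t ∘ₗ Ψ = Ψ ∘ₗ homogeneousComponent t := by
    intro t
    refine (basisMonomials σ K).ext fun m => ?_
    simp only [coe_basisMonomials, LinearMap.comp_apply, hm]
    rw [homogeneousComponent_of_mem (hg m), homogeneousComponent_of_mem
      (isHomogeneous_monomial 1 rfl)]
    split_ifs <;> simp [hm]
  have hc' : ∀ t f, homogeneousComponent t (Ψ f) = Ψ (homogeneousComponent t f) :=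
    fun t f => LinearMap.congr_fun (hc t) f
  have hmap : ∀ t, ∀ f ∈ homogeneousSubmodule σ K t, Ψ f ∈ homogeneousSubmodule σ K t := by
    intro t f hf
    rw [← homogeneousComponent_eq_self hf, ← hc']
    exact homogeneousComponent_mem _ _
  -- Each homogeneous piece is finite-dimensional, so there surjectivity implies injectivity.
  have hinj : ∀ t, Function.Injective (Ψ.restrict (hmap t)) := by
    intro t
    have : Module.Finite K (homogeneousSubmodule σ K t) :=
      Module.Finite.iff_fg.mpr (homogeneousSubmodule_fg σ K t)
    refine LinearMap.injective_iff_surjective.mpr fun y => ?_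
    obtain ⟨f, hf⟩ := hs y
    refine ⟨⟨homogeneousComponent t f, homogeneousComponent_mem _ _⟩, Subtype.ext ?_⟩
    exact (hc' t f).symm.trans 
      ((congrArg _ hf).trans (homogeneousComponent_eq_self y.2))
  rw [← LinearMap.ker_eq_bot, LinearMap.ker_eq_bot']
  intro f hf
  rw [← sum_homogeneousComponent f]
  refine Finset.sum_eq_zero fun t _ => ?_
  have : Ψ.restrict (hmap t) ⟨_, homogeneousComponent_mem t f⟩ = 0 := by
    exact Subtype.ext ((hc' t f).symm.trans (by rw [hf, map_zero]; rfl))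
  exact congrArg Subtype.val ((map_eq_zero_iff _ (hinj t)).mp this)

/-- The exponents that are at most `1` in the first `k` of the chosen variables. -/
def squarefreeSupport {σ : Type*} {n : ℕ} (v : Fin n → σ) (k : ℕ) : Set (σ →₀ ℕ) :=
  {m | ∀ j : Fin n, (j : ℕ) < k → m (v j) ≤ 1}

/-- If `n` quadratic forms reduce all polynomials to combinations of monomials that are squarefree
in `n` chosen variables, and likewise for their initial segments, then these monomials are linearly
independent modulo the forms. -/
theorem eq_zero_of_mem_restrictSupport_of_mem_span {σ K : Type*} [Finite σ] [Field K] {n : ℕ}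
    {v : Fin n → σ} (hv : Function.Injective v) {f : Fin n → MvPolynomial σ K}
    (hf : ∀ k, (f k).IsHomogeneous 2)
    (h : ∀ k ≤ n, restrictSupport K (squarefreeSupport v k) ⊔
      (Ideal.span (f '' {j | (j : ℕ) < k})).restrictScalars K = ⊤)
    {x : MvPolynomial σ K} (hx : x ∈ restrictSupport K (squarefreeSupport v n))
    (hx' : x ∈ Ideal.span (Set.range f)) : x = 0 := by
  classical
  -- In a monomial that is not squarefree, the square of the first repeated chosen variable is
  -- replaced by the corresponding form; squarefree monomials are kept. The linear extension `Ψ`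
  -- preserves degrees.
  let g : (σ →₀ ℕ) → MvPolynomial σ K := fun m =>
    if hm : ∃ j, 2 ≤ m (v j) ∧ ∀ i < j, m (v i) ≤ 1 then
      f hm.choose * monomial (m - Finsupp.single (v hm.choose) 2) 1 else monomial m 1
  have hg1 : ∀ (k : Fin n) (m : σ →₀ ℕ), m ∈ squarefreeSupport v k →
      g (m + Finsupp.single (v k) 2) = f k * monomial m 1 := by
    intro k m hm
    have hP : 2 ≤ (m + Finsupp.single (v k) 2 : σ →₀ ℕ) (v k) ∧
        ∀ i < k, (m + Finsupp.single (v k) 2 : σ →₀ ℕ) (v i) ≤ 1 := by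
      refine ⟨by simp, fun i hi => ?_⟩
      rw [Finsupp.add_apply, Finsupp.single_eq_of_ne (fun e => hi.ne (hv e))]
      exact hm i hi
    have hex : ∃ j, 2 ≤ (m + Finsupp.single (v k) 2 : σ →₀ ℕ) (v j) ∧
      ∀ i < j, (m + Finsupp.single (v k) 2 : σ →₀ ℕ) (v i) ≤ 1 := ⟨k, hP⟩
    have hk : hex.choose = k := by
      obtain ⟨h1, h2⟩ := hex.choose_spec
      rcases lt_trichotomy hex.choose k with hlt | heq | hgt
      · have := hP.2 _ hlt; omega
      · exact heq
      · have := h2 _ hgt; omega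
    simp only [g]
    rw [dif_pos hex, hk, add_tsub_cancel_right]
  have hg2 : ∀ m ∈ squarefreeSupport v n, g m = monomial m 1 := by
    intro m hm
    simp only [g]
    rw [dif_neg]
    rintro ⟨j, hj, -⟩
    have := hm j j.2
    omega
  have hg : ∀ m, (g m).IsHomogeneous m.degree := by
    intro m
    simp only [g]
    split_ifs with hm
    · have h1 : m = (m - Finsupp.single (v hm.choose) 2) + Finsupp.single (v hm.choose) 2 :=
        (tsub_add_cancel_of_le (Finsupp.single_le_iff.mpr hm.choose_spec.1)).symm
      have h2 := (hf hm.choose).mul (isHomogeneous_monomial (R := K) 1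
        (d := m - Finsupp.single (v hm.choose) 2) rfl)
      have h3 := congrArg Finsupp.degree h1
      rw [map_add, Finsupp.degree_single] at h3
      rwa [h3, add_comm]
    · exact isHomogeneous_monomial 1 rfl
  set Ψ := (basisMonomials σ K).constr K g with hΨ
  have hm : ∀ m, Ψ (monomial m 1) = g m := fun m => by
    have := (basisMonomials σ K).constr_basis K g m
    rwa [coe_basisMonomials] at this
  set N := restrictSupport K (squarefreeSupport v n)ᶜ with hN
  have hfix : ∀ y ∈ restrictSupport K (squarefreeSupport v n), Ψ y = y := by
    intro y hy
    rw [restrictSupport_eq_span] at hy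
    refine LinearMap.eqOn_span (f := Ψ) (g := LinearMap.id) ?_ hy
    rintro _ ⟨m, hmm, rfl⟩
    simp only [hm, LinearMap.id_apply]
    exact hg2 m hmm
  have hT : ∀ k : Fin n, ∀ y ∈ restrictSupport K (squarefreeSupport v k),
      f k * y ∈ N.map Ψ := by
    intro k y hy
    rw [restrictSupport_eq_span] at hy
    have : Submodule.span K ((monomial · (1 : K)) '' squarefreeSupport v k) ≤
        (N.map Ψ).comap (LinearMap.mulLeft K (f k)) := by
      rw [Submodule.span_le]
      rintro _ ⟨m, hmm, rfl⟩
      refine ⟨monomial (m + Finsupp.single (v k) 2) 1,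
        (monomial_mem_restrictSupport K).mpr (Or.inl fun hc => ?_), ?_⟩
      · have := hc k k.2
        simp at this
      · rw [hm, hg1 k m hmm]; rfl
    exact this hy
  -- Induction on the number of forms: a coefficient of `f k` splits as `τ + w`, with `τ` squarefree
  -- in the earlier variables and `w` in the ideal of the earlier forms. Then `f k * τ` is the image
  -- under `Ψ` of `v k ^ 2 * τ`, and `f k * w` already lies in the earlier ideal.
  have hI : ∀ k ≤ n, (Ideal.span (f '' {j | (j : ℕ) < k})).restrictScalars K ≤ N.map Ψ := by
    intro k
    induction k with
    | zero =>
      intro _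
      simp
    | succ k ih =>
      intro hk y hy
      have hset : f '' {j | (j : ℕ) < k + 1} = insert (f ⟨k, hk⟩) (f '' {j | (j : ℕ) < k}) := by
        ext z
        simp only [Set.mem_image, Set.mem_ofPred_eq, Set.mem_insert_iff]
        constructor
        · rintro ⟨j, hj, rfl⟩
          rcases Nat.lt_succ_iff_lt_or_eq.mp hj with h1 | h1
          · exact Or.inr ⟨j, h1, rfl⟩
          · exact Or.inl (congrArg f (Fin.ext h1))
        · rintro (rfl | ⟨j, hj, rfl⟩)
          · exact ⟨_, Nat.lt_succ_self k, rfl⟩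
          · exact ⟨j, Nat.lt_succ_of_lt hj, rfl⟩
      rw [hset] at hy
      obtain ⟨a, z, hz, rfl⟩ := Ideal.mem_span_insert.mp hy
      have ha : a ∈ restrictSupport K (squarefreeSupport v k) ⊔
        (Ideal.span (f '' {j | (j : ℕ) < k})).restrictScalars K := by
        rw [h k (by omega)]; trivial
      obtain ⟨τ, hτ, w, hw, rfl⟩ := Submodule.mem_sup.mp ha
      have h1 := hT ⟨k, hk⟩ τ hτ
      have h2 := ih (by omega) (show f ⟨k, hk⟩ * w ∈ Ideal.span (f '' {j | (j : ℕ) < k}) from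
        Ideal.mul_mem_left _ _ hw)
      have h3 := ih (by omega) hz
      have : (τ + w) * f ⟨k, hk⟩ + z = f ⟨k, hk⟩ * τ + f ⟨k, hk⟩ * w + z := by ring
      rw [this]
      exact add_mem (add_mem h1 h2) h3
  have hIn := hI n le_rfl
  have hset : f '' {j | (j : ℕ) < n} = Set.range f := by
    rw [← Set.image_univ]
    congr 1
    ext j
    simp
  have hsurj : Function.Surjective Ψ := by
    rw [← LinearMap.range_eq_top, eq_top_iff, ← h n le_rfl]
    refine sup_le (fun y hy => ⟨y, hfix y hy⟩) (hIn.trans ?_)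
    rintro _ ⟨y, -, rfl⟩
    exact ⟨y, rfl⟩
  rw [hset] at hIn
  -- Now `x` is the image of itself and of some `y` without squarefree monomials. Injectivity gives
  -- `x = y`, and the two supports are disjoint.
  obtain ⟨y, hy, hyx⟩ := hIn hx'
  have hxy : y = x := injective_of_surjective_of_isHomogeneous g hg hsurj
    (hyx.trans (hfix x hx).symm)
  subst hxy
  rw [← support_eq_empty, Finset.eq_empty_iff_forall_notMem]
  exact fun m hmy => hy hmy (hx hmy)

/-! ### Stability of the span of the sixteen squarefree monomials. -/

/-- Four quadratic relations of a special shape force the squarefree monomials in the generators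
to span a submodule that is stable under multiplication by the generators. -/
theorem exists_stable_submodule_of_quadratic_relations {P A : Type*} [CommRing P] [CommRing A]
    [Algebra P A] (s : Fin 4 → A) {a₁ a₀ c₀ l e₁ e₀ κ g₁ g₀ u : A}
    (ha₁ : a₁ ∈ (algebraMap P A).range) (ha₀ : a₀ ∈ (algebraMap P A).range)
    (hc₀ : c₀ ∈ (algebraMap P A).range) (hl : l ∈ (algebraMap P A).range)
    (he₁ : e₁ ∈ (algebraMap P A).range) (he₀ : e₀ ∈ (algebraMap P A).range)
    (hκ : κ ∈ (algebraMap P A).range) (hg₁ : g₁ ∈ (algebraMap P A).range)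
    (hg₀ : g₀ ∈ (algebraMap P A).range) (hu : u ∈ (algebraMap P A).range)
    (r₀ : s 0 ^ 2 = s 3 ^ 2 + a₁ * s 3 + a₀) (r₁ : s 1 ^ 2 = c₀)
    (r₂ : s 2 ^ 2 = l * s 3 ^ 2 + e₁ * s 3 + e₀)
    (r₃ : s 3 ^ 2 = κ * (s 0 * s 1 + s 0 * s 2 + s 1 * s 2) + g₁ * s 3 + g₀)
    (hul : u * (1 - κ ^ 2 * l) = 1) :
    ∃ E ≤ Submodule.span P (Set.range fun t : Finset (Fin 4) => ∏ i ∈ t, s i),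
      1 ∈ E ∧ ∀ i, ∀ a ∈ E, s i * a ∈ E := by
  generalize hx : s 0 = x at *
  generalize hy : s 1 = y at *
  generalize hz : s 2 = z at *
  generalize hw : s 3 = w at *
  set R := (algebraMap P A).range
  have hs : ∀ (E : Submodule P A) {a b : A}, a ∈ R → b ∈ E → a * b ∈ E := by
    rintro E _ b ⟨p, rfl⟩ hb
    rw [← Algebra.smul_def]
    exact E.smul_mem p hb
  set M : Set A := {1, x, y, z, w, x * y, x * z, x * w, y * z, y * w, z * w, x * y * z, x * y * w, x * z * w, y * z * w} with hM
  set E := Submodule.span P M with hE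
  have m : 1 ∈ E := Submodule.subset_span (by simp [hM])
  have m0 : x ∈ E := Submodule.subset_span (by simp [hM])
  have m1 : y ∈ E := Submodule.subset_span (by simp [hM])
  have m2 : z ∈ E := Submodule.subset_span (by simp [hM])
  have m3 : w ∈ E := Submodule.subset_span (by simp [hM])
  have m01 : x * y ∈ E := Submodule.subset_span (by simp [hM])
  have m02 : x * z ∈ E := Submodule.subset_span (by simp [hM])
  have m03 : x * w ∈ E := Submodule.subset_span (by simp [hM])
  have m12 : y * z ∈ E := Submodule.subset_span (by simp [hM])
  have m13 : y * w ∈ E := Submodule.subset_span (by simp [hM])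
  have m23 : z * w ∈ E := Submodule.subset_span (by simp [hM])
  have m012 : x * y * z ∈ E := Submodule.subset_span (by simp [hM])
  have m013 : x * y * w ∈ E := Submodule.subset_span (by simp [hM])
  have m023 : x * z * w ∈ E := Submodule.subset_span (by simp [hM])
  have m123 : y * z * w ∈ E := Submodule.subset_span (by simp [hM])
  -- A two-by-two linear system modulo `E` with determinant `1 - κ ^ 2 * l`, which has inverse `u`.
  have solve : ∀ {p q k k' : A}, k ∈ R → k' ∈ R → k * k' = κ ^ 2 * l → p - k * q ∈ E →
      q - k' * p ∈ E → p ∈ E ∧ q ∈ E := by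
    intro p q k k' hk hk' hkk hp hq
    constructor
    · have : p = u * ((p - k * q) + k * (q - k' * p)) := by
        linear_combination -p * hul + u * p * hkk
      rw [this]
      exact hs E hu (add_mem hp (hs E hk hq))
    · have : q = u * ((q - k' * p) + k' * (p - k * q)) := by
        linear_combination -q * hul + u * q * hkk
      rw [this]
      exact hs E hu (add_mem hq (hs E hk' hp))
  have s3 : w ^ 2 ∈ E := by
    have : w ^ 2 = κ * (x * y) + κ * (x * z) + κ * (y * z) + g₁ * (w) + g₀ * (1) := by linear_combination r₃
    rw [this]; exact add_mem (add_mem (add_mem (add_mem (hs E hκ m01) (hs E hκ m02)) (hs E hκ m12)) (hs E hg₁ m3)) (hs E hg₀ m)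
  have s0 : x ^ 2 ∈ E := by
    have : x ^ 2 = w ^ 2 + a₁ * (w) + a₀ * (1) := by linear_combination r₀
    rw [this]; exact add_mem (add_mem (s3) (hs E ha₁ m3)) (hs E ha₀ m)
  have s1 : y ^ 2 ∈ E := by
    have : y ^ 2 = c₀ * (1) := by linear_combination r₁
    rw [this]; exact hs E hc₀ m
  have s2 : z ^ 2 ∈ E := by
    have : z ^ 2 = l * (w ^ 2) + e₁ * (w) + e₀ * (1) := by linear_combination r₂
    rw [this]; exact add_mem (add_mem (hs E hl s3) (hs E he₁ m3)) (hs E he₀ m)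
  have t31 : w ^ 2 * y ∈ E := by
    have : w ^ 2 * y = κ * c₀ * (x) + κ * (x * y * z) + κ * c₀ * (z) + g₁ * (y * w) + g₀ * (y) := by linear_combination y * r₃ + κ * (x + z) * r₁
    rw [this]; exact add_mem (add_mem (add_mem (add_mem (hs E (mul_mem hκ hc₀) m0) (hs E hκ m012)) (hs E (mul_mem hκ hc₀) m2)) (hs E hg₁ m13)) (hs E hg₀ m1)
  -- Rewriting `w ^ 2 * x` produces `w ^ 2 * z` and conversely, so direct reduction would loop. The
  -- pair is found by `solve`; the same happens for `w ^ 2 * x * y` with `w ^ 2 * y * z`, and for `w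
  -- ^ 2 * x * z` with `w ^ 4`.
  have t30a : w ^ 2 * x - κ * (w ^ 2 * z) ∈ E := by
    have : w ^ 2 * x - κ * (w ^ 2 * z) = κ * (w ^ 2 * y) + κ * a₁ * (y * w) + κ * a₀ * (y) + κ * a₁ * (z * w) + κ * a₀ * (z) + κ * (x * y * z) + g₁ * (x * w) + g₀ * (x) := by linear_combination x * r₃ + κ * (y + z) * r₀
    rw [this]; exact add_mem (add_mem (add_mem (add_mem (add_mem (add_mem (add_mem (hs E hκ t31) (hs E (mul_mem hκ ha₁) m13)) (hs E (mul_mem hκ ha₀) m1)) (hs E (mul_mem hκ ha₁) m23)) (hs E (mul_mem hκ ha₀) m2)) (hs E hκ m012)) (hs E hg₁ m03)) (hs E hg₀ m0)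
  have t32a : w ^ 2 * z - κ * l * (w ^ 2 * x) ∈ E := by
    have : w ^ 2 * z - κ * l * (w ^ 2 * x) = κ * (x * y * z) + κ * e₁ * (x * w) + κ * e₀ * (x) + κ * l * (w ^ 2 * y) + κ * e₁ * (y * w) + κ * e₀ * (y) + g₁ * (z * w) + g₀ * (z) := by linear_combination z * r₃ + κ * (x + y) * r₂
    rw [this]; exact add_mem (add_mem (add_mem (add_mem (add_mem (add_mem (add_mem (hs E hκ m012) (hs E (mul_mem hκ he₁) m03)) (hs E (mul_mem hκ he₀) m0)) (hs E (mul_mem hκ hl) t31)) (hs E (mul_mem hκ he₁) m13)) (hs E (mul_mem hκ he₀) m1)) (hs E hg₁ m23)) (hs E hg₀ m2)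
  obtain ⟨t30, t32⟩ := solve hκ (mul_mem hκ hl) (by ring) t30a t32a
  have t33 : w ^ 3 ∈ E := by
    have : w ^ 3 = κ * (x * y * w) + κ * (x * z * w) + κ * (y * z * w) + g₁ * (w ^ 2) + g₀ * (w) := by linear_combination w * r₃
    rw [this]; exact add_mem (add_mem (add_mem (add_mem (hs E hκ m013) (hs E hκ m023)) (hs E hκ m123)) (hs E hg₁ s3)) (hs E hg₀ m3)
  have q01a : w ^ 2 * (x * y) - κ * (w ^ 2 * (y * z)) ∈ E := by
    have : w ^ 2 * (x * y) - κ * (w ^ 2 * (y * z)) = κ * c₀ * (x ^ 2) + κ * a₁ * (y * z * w) + κ * a₀ * (y * z) + κ * c₀ * (x * z) + g₁ * (x * y * w) + g₀ * (x * y) := by linear_combination x * y * r₃ + κ * (x ^ 2 + x * z) * r₁ + κ * y * z * r₀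
    rw [this]; exact add_mem (add_mem (add_mem (add_mem (add_mem (hs E (mul_mem hκ hc₀) s0) (hs E (mul_mem hκ ha₁) m123)) (hs E (mul_mem hκ ha₀) m12)) (hs E (mul_mem hκ hc₀) m02)) (hs E hg₁ m013)) (hs E hg₀ m01)
  have q12a : w ^ 2 * (y * z) - κ * l * (w ^ 2 * (x * y)) ∈ E := by
    have : w ^ 2 * (y * z) - κ * l * (w ^ 2 * (x * y)) = κ * c₀ * (x * z) + κ * e₁ * (x * y * w) + κ * e₀ * (x * y) + κ * c₀ * (z ^ 2) + g₁ * (y * z * w) + g₀ * (y * z) := by linear_combination y * z * r₃ + κ * (x * z + z ^ 2) * r₁ + κ * x * y * r₂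
    rw [this]; exact add_mem (add_mem (add_mem (add_mem (add_mem (hs E (mul_mem hκ hc₀) m02) (hs E (mul_mem hκ he₁) m013)) (hs E (mul_mem hκ he₀) m01)) (hs E (mul_mem hκ hc₀) s2)) (hs E hg₁ m123)) (hs E hg₀ m12)
  obtain ⟨q01, q12⟩ := solve hκ (mul_mem hκ hl) (by ring) q01a q12a
  have wz2 : w * z ^ 2 ∈ E := by
    have : w * z ^ 2 = l * (w ^ 3) + e₁ * (w ^ 2) + e₀ * (w) := by linear_combination w * r₂
    rw [this]; exact add_mem (add_mem (hs E hl t33) (hs E he₁ s3)) (hs E he₀ m3)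
  have q02a : w ^ 2 * (x * z) - κ * l * w ^ 4 ∈ E := by
    have : w ^ 2 * (x * z) - κ * l * w ^ 4 = κ * (w ^ 2 * (y * z)) + κ * a₁ * (y * z * w) + κ * a₀ * (y * z) + κ * l * (w ^ 2 * (x * y)) + κ * e₁ * (x * y * w) + κ * e₀ * (x * y) + κ * e₁ * (w ^ 3) + κ * e₀ * (w ^ 2) + κ * a₁ * (w * z ^ 2) + κ * a₀ * (z ^ 2) + g₁ * (x * z * w) + g₀ * (x * z) := by linear_combination x * z * r₃ + κ * (y * z + z ^ 2) * r₀ + κ * (x * y + w ^ 2) * r₂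
    rw [this]; exact add_mem (add_mem (add_mem (add_mem (add_mem (add_mem (add_mem (add_mem (add_mem (add_mem (add_mem (hs E hκ q12) (hs E (mul_mem hκ ha₁) m123)) (hs E (mul_mem hκ ha₀) m12)) (hs E (mul_mem hκ hl) q01)) (hs E (mul_mem hκ he₁) m013)) (hs E (mul_mem hκ he₀) m01)) (hs E (mul_mem hκ he₁) t33)) (hs E (mul_mem hκ he₀) s3)) (hs E (mul_mem hκ ha₁) wz2)) (hs E (mul_mem hκ ha₀) s2)) (hs E hg₁ m023)) (hs E hg₀ m02)
  have q33a : w ^ 4 - κ * (w ^ 2 * (x * z)) ∈ E := by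
    have : w ^ 4 - κ * (w ^ 2 * (x * z)) = κ * (w ^ 2 * (x * y)) + κ * (w ^ 2 * (y * z)) + g₁ * (w ^ 3) + g₀ * (w ^ 2) := by linear_combination w ^ 2 * r₃
    rw [this]; exact add_mem (add_mem (add_mem (hs E hκ q01) (hs E hκ q12)) (hs E hg₁ t33)) (hs E hg₀ s3)
  obtain ⟨q02, -⟩ := solve (mul_mem hκ hl) hκ (by ring) q02a q33a
  set F := E ⊔ Submodule.span P {x * y * z * w} with hF
  have hEF : E ≤ F := le_sup_left
  have m0123 : x * y * z * w ∈ F := Submodule.mem_sup_right (Submodule.mem_span_singleton_self _)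
  -- Multiplication by `w` comes before that by `x` and `z`, because those produce terms such as `w
  -- * (w ^ 2 * y)`.
  have hE3 : ∀ a ∈ E, w * a ∈ F := by
    have : E ≤ F.comap (LinearMap.mulLeft P w) := by
      rw [hE, Submodule.span_le, hM]
      simp only [Set.insert_subset_iff, Set.singleton_subset_iff, SetLike.mem_coe, Submodule.mem_comap, LinearMap.mulLeft_apply]
      refine ⟨?_, ?_, ?_, ?_, ?_, ?_, ?_, ?_, ?_, ?_, ?_, ?_, ?_, ?_, ?_⟩
      · rw [show w * (1) = w by ring]; exact hEF m3
      · rw [show w * (x) = x * w by ring]; exact hEF m03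
      · rw [show w * (y) = y * w by ring]; exact hEF m13
      · rw [show w * (z) = z * w by ring]; exact hEF m23
      · rw [show w * (w) = w ^ 2 by ring]; exact hEF s3
      · rw [show w * (x * y) = x * y * w by ring]; exact hEF m013
      · rw [show w * (x * z) = x * z * w by ring]; exact hEF m023
      · rw [show w * (x * w) = w ^ 2 * x by ring]; exact hEF t30
      · rw [show w * (y * z) = y * z * w by ring]; exact hEF m123
      · rw [show w * (y * w) = w ^ 2 * y by ring]; exact hEF t31
      · rw [show w * (z * w) = w ^ 2 * z by ring]; exact hEF t32
      · rw [show w * (x * y * z) = x * y * z * w by ring]; exact m0123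
      · rw [show w * (x * y * w) = w ^ 2 * (x * y) by ring]; exact hEF q01
      · rw [show w * (x * z * w) = w ^ 2 * (x * z) by ring]; exact hEF q02
      · rw [show w * (y * z * w) = w ^ 2 * (y * z) by ring]; exact hEF q12
    exact fun a ha => this ha
  have hE1 : ∀ a ∈ E, y * a ∈ F := by
    have : E ≤ F.comap (LinearMap.mulLeft P y) := by
      rw [hE, Submodule.span_le, hM]
      simp only [Set.insert_subset_iff, Set.singleton_subset_iff, SetLike.mem_coe, Submodule.mem_comap, LinearMap.mulLeft_apply]
      refine ⟨?_, ?_, ?_, ?_, ?_, ?_, ?_, ?_, ?_, ?_, ?_, ?_, ?_, ?_, ?_⟩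
      · rw [show y * (1) = y by ring]; exact hEF m1
      · rw [show y * (x) = x * y by ring]; exact hEF m01
      · rw [show y * (y) = c₀ * (1) by linear_combination (1) * r₁]; exact hs F hc₀ (hEF m)
      · rw [show y * (z) = y * z by ring]; exact hEF m12
      · rw [show y * (w) = y * w by ring]; exact hEF m13
      · rw [show y * (x * y) = c₀ * (x) by linear_combination (x) * r₁]; exact hs F hc₀ (hEF m0)
      · rw [show y * (x * z) = x * y * z by ring]; exact hEF m012
      · rw [show y * (x * w) = x * y * w by ring]; exact hEF m013
      · rw [show y * (y * z) = c₀ * (z) by linear_combination (z) * r₁]; exact hs F hc₀ (hEF m2)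
      · rw [show y * (y * w) = c₀ * (w) by linear_combination (w) * r₁]; exact hs F hc₀ (hEF m3)
      · rw [show y * (z * w) = y * z * w by ring]; exact hEF m123
      · rw [show y * (x * y * z) = c₀ * (x * z) by linear_combination (x * z) * r₁]; exact hs F hc₀ (hEF m02)
      · rw [show y * (x * y * w) = c₀ * (x * w) by linear_combination (x * w) * r₁]; exact hs F hc₀ (hEF m03)
      · rw [show y * (x * z * w) = x * y * z * w by ring]; exact m0123
      · rw [show y * (y * z * w) = c₀ * (z * w) by linear_combination (z * w) * r₁]; exact hs F hc₀ (hEF m23)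
    exact fun a ha => this ha
  have hE0 : ∀ a ∈ E, x * a ∈ F := by
    have : E ≤ F.comap (LinearMap.mulLeft P x) := by
      rw [hE, Submodule.span_le, hM]
      simp only [Set.insert_subset_iff, Set.singleton_subset_iff, SetLike.mem_coe, Submodule.mem_comap, LinearMap.mulLeft_apply]
      refine ⟨?_, ?_, ?_, ?_, ?_, ?_, ?_, ?_, ?_, ?_, ?_, ?_, ?_, ?_, ?_⟩
      · rw [show x * (1) = x by ring]; exact hEF m0
      · rw [show x * (x) = (w ^ 2) + a₁ * (w) + a₀ * (1) by linear_combination (1) * r₀]; exact add_mem (add_mem (hEF s3) (hs F ha₁ (hEF m3))) (hs F ha₀ (hEF m))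
      · rw [show x * (y) = x * y by ring]; exact hEF m01
      · rw [show x * (z) = x * z by ring]; exact hEF m02
      · rw [show x * (w) = x * w by ring]; exact hEF m03
      · rw [show x * (x * y) = (w ^ 2 * y) + a₁ * (y * w) + a₀ * (y) by linear_combination (y) * r₀]; exact add_mem (add_mem (hEF t31) (hs F ha₁ (hEF m13))) (hs F ha₀ (hEF m1))
      · rw [show x * (x * z) = (w ^ 2 * z) + a₁ * (z * w) + a₀ * (z) by linear_combination (z) * r₀]; exact add_mem (add_mem (hEF t32) (hs F ha₁ (hEF m23))) (hs F ha₀ (hEF m2))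
      · rw [show x * (x * w) = (w ^ 3) + a₁ * (w ^ 2) + a₀ * (w) by linear_combination (w) * r₀]; exact add_mem (add_mem (hEF t33) (hs F ha₁ (hEF s3))) (hs F ha₀ (hEF m3))
      · rw [show x * (y * z) = x * y * z by ring]; exact hEF m012
      · rw [show x * (y * w) = x * y * w by ring]; exact hEF m013
      · rw [show x * (z * w) = x * z * w by ring]; exact hEF m023
      · rw [show x * (x * y * z) = (w ^ 2 * (y * z)) + a₁ * (y * z * w) + a₀ * (y * z) by linear_combination (y * z) * r₀]; exact add_mem (add_mem (hEF q12) (hs F ha₁ (hEF m123))) (hs F ha₀ (hEF m12))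
      · rw [show x * (x * y * w) = (w * (w ^ 2 * y)) + a₁ * (w ^ 2 * y) + a₀ * (y * w) by linear_combination (y * w) * r₀]; exact add_mem (add_mem (hE3 _ t31) (hs F ha₁ (hEF t31))) (hs F ha₀ (hEF m13))
      · rw [show x * (x * z * w) = (w * (w ^ 2 * z)) + a₁ * (w ^ 2 * z) + a₀ * (z * w) by linear_combination (z * w) * r₀]; exact add_mem (add_mem (hE3 _ t32) (hs F ha₁ (hEF t32))) (hs F ha₀ (hEF m23))
      · rw [show x * (y * z * w) = x * y * z * w by ring]; exact m0123
    exact fun a ha => this ha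
  have hE2 : ∀ a ∈ E, z * a ∈ F := by
    have : E ≤ F.comap (LinearMap.mulLeft P z) := by
      rw [hE, Submodule.span_le, hM]
      simp only [Set.insert_subset_iff, Set.singleton_subset_iff, SetLike.mem_coe, Submodule.mem_comap, LinearMap.mulLeft_apply]
      refine ⟨?_, ?_, ?_, ?_, ?_, ?_, ?_, ?_, ?_, ?_, ?_, ?_, ?_, ?_, ?_⟩
      · rw [show z * (1) = z by ring]; exact hEF m2
      · rw [show z * (x) = x * z by ring]; exact hEF m02
      · rw [show z * (y) = y * z by ring]; exact hEF m12
      · rw [show z * (z) = l * (w ^ 2) + e₁ * (w) + e₀ * (1) by linear_combination (1) * r₂]; exact add_mem (add_mem (hs F hl (hEF s3)) (hs F he₁ (hEF m3))) (hs F he₀ (hEF m))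
      · rw [show z * (w) = z * w by ring]; exact hEF m23
      · rw [show z * (x * y) = x * y * z by ring]; exact hEF m012
      · rw [show z * (x * z) = l * (w ^ 2 * x) + e₁ * (x * w) + e₀ * (x) by linear_combination (x) * r₂]; exact add_mem (add_mem (hs F hl (hEF t30)) (hs F he₁ (hEF m03))) (hs F he₀ (hEF m0))
      · rw [show z * (x * w) = x * z * w by ring]; exact hEF m023
      · rw [show z * (y * z) = l * (w ^ 2 * y) + e₁ * (y * w) + e₀ * (y) by linear_combination (y) * r₂]; exact add_mem (add_mem (hs F hl (hEF t31)) (hs F he₁ (hEF m13))) (hs F he₀ (hEF m1))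
      · rw [show z * (y * w) = y * z * w by ring]; exact hEF m123
      · rw [show z * (z * w) = l * (w ^ 3) + e₁ * (w ^ 2) + e₀ * (w) by linear_combination (w) * r₂]; exact add_mem (add_mem (hs F hl (hEF t33)) (hs F he₁ (hEF s3))) (hs F he₀ (hEF m3))
      · rw [show z * (x * y * z) = l * (w ^ 2 * (x * y)) + e₁ * (x * y * w) + e₀ * (x * y) by linear_combination (x * y) * r₂]; exact add_mem (add_mem (hs F hl (hEF q01)) (hs F he₁ (hEF m013))) (hs F he₀ (hEF m01))
      · rw [show z * (x * y * w) = x * y * z * w by ring]; exact m0123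
      · rw [show z * (x * z * w) = l * (w * (w ^ 2 * x)) + e₁ * (w ^ 2 * x) + e₀ * (x * w) by linear_combination (x * w) * r₂]; exact add_mem (add_mem (hs F hl (hE3 _ t30)) (hs F he₁ (hEF t30))) (hs F he₀ (hEF m03))
      · rw [show z * (y * z * w) = l * (w * (w ^ 2 * y)) + e₁ * (w ^ 2 * y) + e₀ * (y * w) by linear_combination (y * w) * r₂]; exact add_mem (add_mem (hs F hl (hE3 _ t31)) (hs F he₁ (hEF t31))) (hs F he₀ (hEF m13))
    exact fun a ha => this ha
  have hF3 : w * (x * y * z * w) ∈ F := by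
    rw [show w * (x * y * z * w) = z * (w ^ 2 * (x * y)) by ring]; exact hE2 _ q01
  have hF1 : y * (x * y * z * w) ∈ F := by
    rw [show y * (x * y * z * w) = c₀ * (x * z * w) by linear_combination x * z * w * r₁]
    exact hs F hc₀ (hEF m023)
  have hF0 : x * (x * y * z * w) ∈ F := by
    rw [show x * (x * y * z * w) = w * (w ^ 2 * (y * z)) + a₁ * (w ^ 2 * (y * z)) +
      a₀ * (y * z * w) by linear_combination y * z * w * r₀]
    exact add_mem (add_mem (hE3 _ q12) (hs F ha₁ (hEF q12))) (hs F ha₀ (hEF m123))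
  have hF2 : z * (x * y * z * w) ∈ F := by
    rw [show z * (x * y * z * w) = l * (w * (w ^ 2 * (x * y))) + e₁ * (w ^ 2 * (x * y)) +
      e₀ * (x * y * w) by linear_combination x * y * w * r₂]
    exact add_mem (add_mem (hs F hl (hE3 _ q01)) (hs F he₁ (hEF q01))) (hs F he₀ (hEF m013))
  have key : ∀ v : A, (∀ a ∈ E, v * a ∈ F) → v * (x * y * z * w) ∈ F → ∀ a ∈ F, v * a ∈ F := by
    intro v h1 h2 a ha
    obtain ⟨b, hb, c, hc, rfl⟩ := Submodule.mem_sup.mp ha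
    obtain ⟨p, rfl⟩ := Submodule.mem_span_singleton.mp hc
    rw [mul_add, mul_smul_comm]
    exact add_mem (h1 b hb) (F.smul_mem p h2)
  refine ⟨F, ?_, hEF m, ?_⟩
  · have hmem : ∀ t : Finset (Fin 4), ∏ i ∈ t, s i ∈
        Submodule.span P (Set.range fun t : Finset (Fin 4) => ∏ i ∈ t, s i) :=
      fun t => Submodule.subset_span ⟨t, rfl⟩
    rw [hF, hE, sup_le_iff, Submodule.span_le, Submodule.span_le, hM]
    simp only [Set.insert_subset_iff, Set.singleton_subset_iff, SetLike.mem_coe]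
    refine ⟨⟨?_, ?_, ?_, ?_, ?_, ?_, ?_, ?_, ?_, ?_, ?_, ?_, ?_, ?_, ?_⟩, ?_⟩
    · simpa [hx, hy, hz, hw, mul_assoc] using hmem ∅
    · simpa [hx, hy, hz, hw, mul_assoc] using hmem {0}
    · simpa [hx, hy, hz, hw, mul_assoc] using hmem {1}
    · simpa [hx, hy, hz, hw, mul_assoc] using hmem {2}
    · simpa [hx, hy, hz, hw, mul_assoc] using hmem {3}
    · simpa [hx, hy, hz, hw, mul_assoc] using hmem {0, 1}
    · simpa [hx, hy, hz, hw, mul_assoc] using hmem {0, 2}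
    · simpa [hx, hy, hz, hw, mul_assoc] using hmem {0, 3}
    · simpa [hx, hy, hz, hw, mul_assoc] using hmem {1, 2}
    · simpa [hx, hy, hz, hw, mul_assoc] using hmem {1, 3}
    · simpa [hx, hy, hz, hw, mul_assoc] using hmem {2, 3}
    · simpa [hx, hy, hz, hw, mul_assoc] using hmem {0, 1, 2}
    · simpa [hx, hy, hz, hw, mul_assoc] using hmem {0, 1, 3}
    · simpa [hx, hy, hz, hw, mul_assoc] using hmem {0, 2, 3}
    · simpa [hx, hy, hz, hw, mul_assoc] using hmem {1, 2, 3}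
    · simpa [hx, hy, hz, hw, mul_assoc] using hmem {0, 1, 2, 3}
  · intro i
    fin_cases i
    · simpa [hx] using key x hE0 hF0
    · simpa [hy] using key y hE1 hF1
    · simpa [hz] using key z hE2 hF2
    · simpa [hw] using key w hE3 hF3

theorem MvPolynomial.eq_top_of_X_mul_mem {σ K : Type*} [Field K]
    (E : Submodule K (MvPolynomial σ K)) (h1 : 1 ∈ E) (h : ∀ i, ∀ p ∈ E, X i * p ∈ E) : E = ⊤ := by
  rw [eq_top_iff]
  rintro p -
  induction p using MvPolynomial.induction_on with
  | C a =>
    rw [← mul_one (C a), ← smul_eq_C_mul]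
    exact E.smul_mem a h1
  | add p q hp hq => exact add_mem hp hq
  | mul_X p i hp => rw [mul_comm]; exact h i p hp

/-- Quadratic forms with leading squares of variables reduce all polynomials to combinations of
monomials that are squarefree in these variables. -/
theorem restrictSupport_squarefreeSupport_sup_span {σ K : Type*} [Field K] {n : ℕ} {v : Fin n → σ}
    {k : ℕ} (f Q : Fin n → MvPolynomial σ K)
    (hf : ∀ j : Fin n, (j : ℕ) < k → f j = X (v j) ^ 2 - Q j)
    (hQ : ∀ j : Fin n, (j : ℕ) < k → Q j ∈ supported K (v '' {i | (i : ℕ) < k})ᶜ) :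
    restrictSupport K (squarefreeSupport v k) ⊔
      (Ideal.span (f '' {j | (j : ℕ) < k})).restrictScalars K = ⊤ := by
  classical
  have hadd : ∀ (a : σ →₀ ℕ), (∀ i : Fin n, (i : ℕ) < k → a (v i) = 0) →
      ∀ m ∈ squarefreeSupport v k, a + m ∈ squarefreeSupport v k := by
    intro a ha m hm j hj
    rw [Finsupp.add_apply, ha j hj, zero_add]
    exact hm j hj
  have hmul : ∀ j : Fin n, (j : ℕ) < k → ∀ m ∈ squarefreeSupport v k,
      Q j * monomial m 1 ∈ restrictSupport K (squarefreeSupport v k) := by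
    intro j hj m hm
    rw [mem_restrictSupport_iff]
    intro a ha
    obtain ⟨c, hc, d, hd, rfl⟩ := Finset.mem_add.mp (support_mul _ _ ha)
    rw [Finset.mem_singleton.mp (support_monomial_subset hd)]
    refine hadd c (fun i hi => ?_) m hm
    by_contra hne
    have := mem_supported.mp (hQ j hj) ((mem_vars_iff_mem_support _).mpr ⟨c, hc, Finsupp.mem_support_iff.mpr hne⟩)
    exact this ⟨i, hi, rfl⟩
  refine eq_top_of_X_mul_mem _ (Submodule.mem_sup_left ?_) ?_
  · exact (monomial_mem_restrictSupport K (m := 0)).mpr (Or.inl fun j _ => by simp)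
  · intro i p hp
    obtain ⟨τ, hτ, w, hw, rfl⟩ := Submodule.mem_sup.mp hp
    rw [mul_add]
    refine add_mem ?_ (Submodule.mem_sup_right (Ideal.mul_mem_left _ _ hw))
    rw [restrictSupport_eq_span] at hτ
    set E := restrictSupport K (squarefreeSupport v k) ⊔
      (Ideal.span (f '' {j | (j : ℕ) < k})).restrictScalars K
    have : Submodule.span K ((monomial · (1 : K)) '' squarefreeSupport v k) ≤
        E.comap (LinearMap.mulLeft K (X i)) := by
      rw [Submodule.span_le]
      rintro _ ⟨m, hm, rfl⟩
      change X i * monomial m 1 ∈ E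
      have hX : X i * monomial m (1 : K) = monomial (Finsupp.single i 1 + m) 1 := by
        rw [X, monomial_mul, one_mul]
      by_cases hs : Finsupp.single i 1 + m ∈ squarefreeSupport v k
      · rw [hX]
        exact Submodule.mem_sup_left ((monomial_mem_restrictSupport K).mpr (Or.inl hs))
      · simp only [squarefreeSupport, Set.mem_ofPred_eq, not_forall] at hs
        obtain ⟨j, hj, h2⟩ := hs
        have hmj := hm j hj
        have hij : i = v j := by
          by_contra hne
          rw [Finsupp.add_apply, Finsupp.single_eq_of_ne (Ne.symm hne), zero_add] at h2
          exact h2 hmj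
        subst hij
        rw [Finsupp.add_apply, Finsupp.single_eq_same] at h2
        have hle : Finsupp.single (v j) 1 ≤ m := Finsupp.single_le_iff.mpr (by omega)
        have hm' : m - Finsupp.single (v j) 1 ∈ squarefreeSupport v k := by
          intro i hi
          rw [Finsupp.tsub_apply]
          exact (Nat.sub_le _ _).trans (hm i hi)
        have : X (v j) * monomial m (1 : K) = f j * monomial (m - Finsupp.single (v j) 1) 1 +
            Q j * monomial (m - Finsupp.single (v j) 1) 1 := by
          have h3 : monomial m (1 : K) = X (v j) * monomial (m - Finsupp.single (v j) 1) 1 := by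
            rw [X, monomial_mul, one_mul, add_tsub_cancel_of_le hle]
          rw [h3, hf j hj]
          ring
        rw [this]
        exact add_mem (Submodule.mem_sup_right (Ideal.mul_mem_right _ _
          (Ideal.subset_span ⟨j, hj, rfl⟩))) (Submodule.mem_sup_left (hmul j hj _ hm'))
    exact this hτ

/-! ### The forms in adapted coordinates: a free quotient of rank sixteen. -/

/-- The quadratic form `p ^ 2 = q ^ 2 + r ^ 2 - c q r` in three given linear forms. -/
noncomputable def conicForm {σ K : Type*} [Field K] (c : K) (p q r : MvPolynomial σ K) :
    MvPolynomial σ K :=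
  p ^ 2 - (q ^ 2 + r ^ 2 - C c * q * r)

theorem isHomogeneous_conicForm {σ K : Type*} [Field K] (c : K) {p q r : MvPolynomial σ K}
    (hp : p.IsHomogeneous 1) (hq : q.IsHomogeneous 1) (hr : r.IsHomogeneous 1) :
    (conicForm c p q r).IsHomogeneous 2 :=
  (hp.pow 2).sub (((hq.pow 2).add (hr.pow 2)).sub ((hq.C_mul c).mul hr))

/-- The variables of the fibres of the linear projection. -/
noncomputable abbrev fibreVar (K : Type*) [Field K] (i : Fin 4) : MvPolynomial (Fin 4 ⊕ Fin 4) K :=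
  X (Sum.inl i)

/-- The variables of the base of the linear projection. -/
noncomputable abbrev baseVar (K : Type*) [Field K] (i : Fin 4) : MvPolynomial (Fin 4 ⊕ Fin 4) K :=
  X (Sum.inr i)

/-- The quadratic forms in adapted coordinates: the first three fibre variables are the roots,
the quaternary point has coordinates `z, u₁, u₂, l z + u₃`, where `z` is the last fibre variable
and the `uⱼ` are the base variables. -/
noncomputable def adaptedForm {K : Type*} [Field K] (b : Fin 4 → K) (l : K) :
    Fin 4 → MvPolynomial (Fin 4 ⊕ Fin 4) K :=
  ![conicForm (2 * b 0) (fibreVar K 0) (fibreVar K 3) (baseVar K 1),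
    conicForm (2 * b 1) (fibreVar K 1) (baseVar K 1) (baseVar K 2),
    conicForm (2 * b 2) (fibreVar K 2) (baseVar K 2) (C l * fibreVar K 3 + baseVar K 3),
    conicForm (2 * b 3) (fibreVar K 0 + fibreVar K 1 + fibreVar K 2)
      (C l * fibreVar K 3 + baseVar K 3) (fibreVar K 3)]

theorem isHomogeneous_adaptedForm {K : Type*} [Field K] (b : Fin 4 → K) (l : K) (k : Fin 4) :
    (adaptedForm b l k).IsHomogeneous 2 := by
  have hX : ∀ i, (X i : MvPolynomial (Fin 4 ⊕ Fin 4) K).IsHomogeneous 1 := isHomogeneous_X K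
  have hy : (C l * fibreVar K 3 + baseVar K 3).IsHomogeneous 1 := ((hX _).C_mul l).add (hX _)
  fin_cases k
  · exact isHomogeneous_conicForm _ (hX _) (hX _) (hX _)
  · exact isHomogeneous_conicForm _ (hX _) (hX _) (hX _)
  · exact isHomogeneous_conicForm _ (hX _) (hX _) hy
  · exact isHomogeneous_conicForm _ (((hX _).add (hX _)).add (hX _)) hy (hX _)

/-- The coordinate ring of the linear projection, acting through the variables `inr j`. -/
noncomputable abbrev baseAlgebra (K : Type*) [Field K] :
    Algebra (MvPolynomial (Fin 4) K) (MvPolynomial (Fin 4 ⊕ Fin 4) K) :=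
  (rename Sum.inr : MvPolynomial (Fin 4) K →ₐ[K] _).toRingHom.toAlgebra

section

attribute [local instance] baseAlgebra

theorem baseAlgebra_algebraMap {K : Type*} [Field K] (p : MvPolynomial (Fin 4) K) :
    algebraMap (MvPolynomial (Fin 4) K) (MvPolynomial (Fin 4 ⊕ Fin 4) K) p = rename Sum.inr p := rfl

theorem base_smul_mk {K : Type*} [Field K] (I : Ideal (MvPolynomial (Fin 4 ⊕ Fin 4) K))
    (p : MvPolynomial (Fin 4) K) (q : MvPolynomial (Fin 4 ⊕ Fin 4) K) :
    p • Ideal.Quotient.mk I q = Ideal.Quotient.mk I (rename Sum.inr p * q) := by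
  rw [← baseAlgebra_algebraMap, ← Algebra.smul_def]
  rfl

/-- Viewed as polynomials in the fibre variables over the ring in the base variables, distinct
squarefree monomials have distinct exponents, so each `p t` is a coefficient of the sum. -/
theorem eq_zero_of_sum_rename_mul_prod {K : Type*} [Field K]
    (p : Finset (Fin 4) → MvPolynomial (Fin 4) K)
    (h : ∑ t, rename Sum.inr (p t) *
      ∏ i ∈ t, fibreVar K i = 0) : p = 0 := by
  classical
  let e : Finset (Fin 4) → (Fin 4 →₀ ℕ) := fun t => ∑ i ∈ t, Finsupp.single i 1
  have he : ∀ t i, e t i = if i ∈ t then 1 else 0 := by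
    intro t i
    simp [e, Finsupp.finsetSum_apply, Finsupp.single_apply]
  have hinj : ∀ t t', e t = e t' → t = t' := by
    intro t t' h
    ext i
    have := DFunLike.congr_fun h i
    rw [he, he] at this
    by_cases h1 : i ∈ t <;> by_cases h2 : i ∈ t' <;> simp_all
  have h2 := congrArg (sumAlgEquiv K (Fin 4) (Fin 4)) h
  have hr : ∀ q : MvPolynomial (Fin 4) K,
      sumAlgEquiv K (Fin 4) (Fin 4) (rename Sum.inr q) = C q := by
    intro q
    induction q using MvPolynomial.induction_on with
    | C a => rw [rename_C, sumAlgEquiv_C_inl]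
    | add p q hp hq => simp [hp, hq]
    | mul_X p i hp => rw [map_mul, map_mul, hp, rename_X, sumAlgEquiv_X_inr, map_mul]
  have hp : ∀ t : Finset (Fin 4), sumAlgEquiv K (Fin 4) (Fin 4) (∏ i ∈ t, fibreVar K i) =
      monomial (e t) 1 := by
    intro t
    rw [map_prod, monomial_sum_one]
    exact Finset.prod_congr rfl fun i _ => sumAlgEquiv_X_inl _ _ _ i
  simp only [map_sum, map_mul, hr, hp, map_zero] at h2
  funext t
  have h3 := congrArg (coeff (e t)) h2
  rw [coeff_sum, Finset.sum_eq_single t] at h3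
  · simpa using h3
  · intro t' _ hne
    rw [coeff_C_mul, coeff_monomial, if_neg (fun h => hne (hinj _ _ h)), mul_zero]
  · simp

variable {K : Type*} [Field K] (b : Fin 4 → K) (l : K)

/-- The squares on the two sides of `e3 - e0 - e1 - e2` cancel in `s 3`, and the only remaining `s 3
^ 2` comes from the mixed term `2 * d 3 * l * s 3 ^ 2`. Dividing by `2` and by `-(d 3 * l)` yields
the relation for `s 3 ^ 2` with `κ = k`. The general lemma is applied with `l ^ 2` in place of its
`l`. -/
theorem exists_stable_submodule_of_conics {P A : Type*} [CommRing P] [CommRing A] [Algebra P A]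
    (s : Fin 4 → A) {c d : Fin 4 → A} {l k h u : A}
    (hc : ∀ i, c i ∈ (algebraMap P A).range) (hd : ∀ i, d i ∈ (algebraMap P A).range)
    (hl : l ∈ (algebraMap P A).range) (hk : k ∈ (algebraMap P A).range)
    (ht : 2 ∈ (algebraMap P A).range)
    (hu : u ∈ (algebraMap P A).range)
    (e0 : s 0 ^ 2 - (s 3 ^ 2 + c 1 ^ 2 - 2 * d 0 * s 3 * c 1) = 0)
    (e1 : s 1 ^ 2 - (c 1 ^ 2 + c 2 ^ 2 - 2 * d 1 * c 1 * c 2) = 0)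
    (e2 : s 2 ^ 2 - (c 2 ^ 2 + (l * s 3 + c 3) ^ 2 - 2 * d 2 * c 2 * (l * s 3 + c 3)) = 0)
    (e3 : (s 0 + s 1 + s 2) ^ 2 -
      ((l * s 3 + c 3) ^ 2 + s 3 ^ 2 - 2 * d 3 * (l * s 3 + c 3) * s 3) = 0)
    (hdl : d 3 * l * k = -1) (hh : 2 * h = 1) (hul : u * (1 - k ^ 2 * l ^ 2) = 1) :
    ∃ E ≤ Submodule.span P (Set.range fun t : Finset (Fin 4) => ∏ i ∈ t, s i),
      1 ∈ E ∧ ∀ i, ∀ a ∈ E, s i * a ∈ E := by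
  have hc1 := hc 1
  have hc2 := hc 2
  have hc3 := hc 3
  have hd0 := hd 0
  have hd1 := hd 1
  have hd2 := hd 2
  have hd3 := hd 3
  refine exists_stable_submodule_of_quadratic_relations s
    (a₁ := -(2 * d 0 * c 1)) (a₀ := c 1 ^ 2) (c₀ := c 1 ^ 2 + c 2 ^ 2 - 2 * d 1 * c 1 * c 2)
    (l := l ^ 2) (e₁ := 2 * l * c 3 - 2 * d 2 * c 2 * l)
    (e₀ := c 2 ^ 2 + c 3 ^ 2 - 2 * d 2 * c 2 * c 3) (κ := k)
    (g₁ := k * (d 3 * c 3 - d 0 * c 1 - d 2 * c 2 * l))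
    (g₀ := k * (c 1 ^ 2 + c 2 ^ 2 - d 1 * c 1 * c 2 - d 2 * c 2 * c 3))
    ?_ ?_ ?_ ?_ ?_ ?_ ?_ ?_ ?_ hu ?_ ?_ ?_ ?_ hul
  any_goals first | (apply_rules [add_mem, sub_mem, mul_mem, pow_mem, neg_mem]) | skip
  · linear_combination e0
  · linear_combination e1
  · linear_combination e2
  · linear_combination -(h * k) * (e3 - e0 - e1 - e2) + s 3 ^ 2 * hdl +
      k * (s 0 * s 1 + s 0 * s 2 + s 1 * s 2 + c 1 ^ 2 + c 2 ^ 2 - d 0 * s 3 * c 1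
        - d 1 * c 1 * c 2 - d 2 * c 2 * (l * s 3 + c 3) + d 3 * (l * s 3 + c 3) * s 3) * hh

theorem adaptedForm_quotient_span_eq_top (h2 : (2 : K) ≠ 0) (hb0 : b 3 ≠ 0) (hb1 : b 3 ^ 2 ≠ 1)
    (hl : l ≠ 0) :
    Submodule.span (MvPolynomial (Fin 4) K) (Set.range fun t : Finset (Fin 4) =>
      Ideal.Quotient.mk (Ideal.span (Set.range (adaptedForm b l))) (∏ i ∈ t, fibreVar K i)) = ⊤ := by
  set I := Ideal.span (Set.range (adaptedForm b l)) with hI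
  set π := Ideal.Quotient.mk I with hπ
  have hmem : ∀ k, π (adaptedForm b l k) = 0 := fun k =>
    Ideal.Quotient.eq_zero_iff_mem.mpr (Ideal.subset_span ⟨k, rfl⟩)
  have hr : ∀ p : MvPolynomial (Fin 4) K,
      π (rename Sum.inr p) ∈ (algebraMap (MvPolynomial (Fin 4) K) (_ ⧸ I)).range := fun p => ⟨p, rfl⟩
  have hC : ∀ c : K, π (C c) ∈ (algebraMap (MvPolynomial (Fin 4) K) (_ ⧸ I)).range := fun c => by
    simpa using hr (C c)
  have hu : ∀ i, π (baseVar K i) ∈ (algebraMap (MvPolynomial (Fin 4) K) (_ ⧸ I)).range :=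
    fun i => by simpa using hr (X i)
  have e0 := hmem 0
  have e1 := hmem 1
  have e2 := hmem 2
  have e3 := hmem 3
  simp only [adaptedForm, conicForm, Matrix.cons_val, map_sub, map_add, map_mul, map_pow] at e0 e1 e2 e3
  have hπ2 : π (C 2) = 2 := by rw [map_ofNat, map_ofNat]
  rw [hπ2] at e0 e1 e2 e3
  set x := π (fibreVar K 0)
  set y := π (fibreVar K 1)
  set z := π (fibreVar K 2)
  set w := π (fibreVar K 3)
  have hk : π (C (b 3)) * π (C l) * π (C (-(b 3 * l)⁻¹)) = -1 := by
    rw [← map_mul, ← map_mul, ← C_mul, ← C_mul]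
    rw [show b 3 * l * -(b 3 * l)⁻¹ = -1 by field_simp]
    simp
  have hh : (2 : _ ⧸ I) * π (C (2⁻¹)) = 1 := by
    rw [← hπ2, ← map_mul, ← C_mul, mul_inv_cancel₀ h2]; simp
  -- With `k = -(b 3 * l)⁻¹` the parameter `l` drops out: `1 - k ^ 2 * l ^ 2 = 1 - (b 3 ^ 2)⁻¹`, a
  -- nonzero constant because `b 3 ^ 2 ≠ 1`.
  have hul : π (C (1 - (b 3 ^ 2)⁻¹)⁻¹) * (1 - π (C (-(b 3 * l)⁻¹)) ^ 2 * π (C l) ^ 2) = 1 := by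
    have h1 : 1 - (b 3 ^ 2)⁻¹ ≠ 0 := by
      intro h
      apply hb1
      have := sub_eq_zero.mp h
      field_simp at this
      exact this
    have h3 : (1 - (b 3 ^ 2)⁻¹)⁻¹ * (1 - (-(b 3 * l)⁻¹) ^ 2 * l ^ 2) = 1 := by
      rw [show (1 - (-(b 3 * l)⁻¹) ^ 2 * l ^ 2) = 1 - (b 3 ^ 2)⁻¹ by field_simp]
      exact inv_mul_cancel₀ h1
    have := congrArg (fun c => π (C c)) h3
    simpa only [map_mul, map_sub, map_pow, map_one] using this
  have ht : (2 : _ ⧸ I) ∈ (algebraMap (MvPolynomial (Fin 4) K) (_ ⧸ I)).range := hπ2 ▸ hC 2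
  set k := π (C (-(b 3 * l)⁻¹)) with hkdef
  obtain ⟨F, hF, hF1, hFs⟩ := exists_stable_submodule_of_conics (P := MvPolynomial (Fin 4) K)
    (fun i => π (fibreVar K i)) hu (fun i => hC (b i)) (hC l) (hC _) ht (hC _)
    e0 e1 e2 e3 hk hh hul
  have hall : ∀ p, π p ∈ F := by
    intro p
    induction p using MvPolynomial.induction_on with
    | C a =>
      have : π (C a) = (C a : MvPolynomial (Fin 4) K) • (1 : _ ⧸ I) := by
        rw [← map_one π, base_smul_mk, rename_C, mul_one]
      rw [this]
      exact F.smul_mem _ hF1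
    | add p q hp hq => rw [map_add]; exact add_mem hp hq
    | mul_X p i hp =>
      rw [map_mul, mul_comm]
      rcases i with i | i
      · exact hFs i _ hp
      · have : π (X (Sum.inr i)) * π p = (X i : MvPolynomial (Fin 4) K) • π p := by
          rw [base_smul_mk, rename_X, map_mul]
        rw [this]
        exact F.smul_mem _ hp
  rw [eq_top_iff]
  rintro a -
  obtain ⟨p, rfl⟩ := Ideal.Quotient.mk_surjective a
  simpa only [map_prod] using hF (hall p)

theorem prod_fibreVar_eq_monomial (t : Finset (Fin 4)) :
    ∏ i ∈ t, fibreVar K i =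
      monomial (∑ i ∈ t, Finsupp.single (Sum.inl i : Fin 4 ⊕ Fin 4) 1) 1 := by
  rw [monomial_sum_one]
  rfl

theorem rename_mul_prod_mem_restrictSupport (p : MvPolynomial (Fin 4) K) (t : Finset (Fin 4)) :
    rename Sum.inr p * ∏ i ∈ t, fibreVar K i ∈
      restrictSupport K (squarefreeSupport (Sum.inl : Fin 4 → Fin 4 ⊕ Fin 4) 4) := by
  classical
  rw [prod_fibreVar_eq_monomial, mem_restrictSupport_iff]
  intro a ha j _
  obtain ⟨c, hc, d, hd, rfl⟩ := Finset.mem_add.mp (support_mul _ _ ha)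
  rw [Finset.mem_singleton.mp (support_monomial_subset hd), Finsupp.add_apply]
  have h0 : c (Sum.inl j) = 0 := by
    obtain ⟨e, rfl, -⟩ := coeff_rename_ne_zero _ _ _ (mem_support_iff.mp hc)
    exact Finsupp.mapDomain_of_notMem_range _ _ (by simp)
  rw [h0, zero_add, Finsupp.finsetSum_apply]
  simp only [Finsupp.single_apply, Sum.inl.injEq, Finset.sum_ite_eq']
  split_ifs <;> simp

/-- For `k < 4` the forms involved have the leading squares of their own root variables, and their
remaining terms avoid those variables, so division suffices. Only `k = 4` needs the spanning
theorem. -/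
theorem adaptedForm_squarefreeSupport_sup_span (h2 : (2 : K) ≠ 0) (hb0 : b 3 ≠ 0)
    (hb1 : b 3 ^ 2 ≠ 1) (hl : l ≠ 0) (k : ℕ) (hk : k ≤ 4) :
    restrictSupport K (squarefreeSupport (Sum.inl : Fin 4 → Fin 4 ⊕ Fin 4) k) ⊔
      (Ideal.span (adaptedForm b l '' {j | (j : ℕ) < k})).restrictScalars K = ⊤ := by
  rcases Nat.lt_or_ge k 4 with hk3 | hk4
  · let s : Set (Fin 4 ⊕ Fin 4) := (Sum.inl '' {i : Fin 4 | (i : ℕ) < k})ᶜ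
    have hz : fibreVar K 3 ∈ supported K s := X_mem_supported.mpr (by simp [s]; omega)
    have hu : ∀ i, baseVar K i ∈ supported K s := fun i => X_mem_supported.mpr (by simp [s])
    have hC : ∀ c : K, C c ∈ supported K s := fun c => (supported K s).algebraMap_mem c
    refine restrictSupport_squarefreeSupport_sup_span _
      ![fibreVar K 3 ^ 2 + baseVar K 1 ^ 2 - C (2 * b 0) * fibreVar K 3 * baseVar K 1,
        baseVar K 1 ^ 2 + baseVar K 2 ^ 2 - C (2 * b 1) * baseVar K 1 * baseVar K 2,
        baseVar K 2 ^ 2 + (C l * fibreVar K 3 + baseVar K 3) ^ 2 -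
          C (2 * b 2) * baseVar K 2 * (C l * fibreVar K 3 + baseVar K 3), 0] ?_ ?_
    · intro j hj
      fin_cases j
      · rfl
      · rfl
      · rfl
      · simp at hj; omega
    · intro j hj
      change _ ∈ supported K s
      fin_cases j
      · exact sub_mem (add_mem (pow_mem hz 2) (pow_mem (hu 1) 2))
          (mul_mem (mul_mem (hC _) hz) (hu 1))
      · exact sub_mem (add_mem (pow_mem (hu 1) 2) (pow_mem (hu 2) 2))
          (mul_mem (mul_mem (hC _) (hu 1)) (hu 2))
      · have hy := add_mem (mul_mem (hC l) hz) (hu 3)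
        exact sub_mem (add_mem (pow_mem (hu 2) 2) (pow_mem hy 2))
          (mul_mem (mul_mem (hC _) (hu 2)) hy)
      · exact zero_mem _
  · obtain rfl : k = 4 := by omega
    have hset : adaptedForm b l '' {j | (j : ℕ) < 4} = Set.range (adaptedForm b l) := by
      rw [← Set.image_univ]
      congr 1
      ext j
      simp
    rw [hset, eq_top_iff]
    rintro p -
    have hp : Ideal.Quotient.mk (Ideal.span (Set.range (adaptedForm b l))) p ∈ (⊤ :
        Submodule (MvPolynomial (Fin 4) K) (_ ⧸ Ideal.span (Set.range (adaptedForm b l)))) := trivial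
    rw [← adaptedForm_quotient_span_eq_top b l h2 hb0 hb1 hl,
      Submodule.mem_span_range_iff_exists_fun] at hp
    obtain ⟨c, hc⟩ := hp
    simp only [base_smul_mk] at hc
    have h1 : Ideal.Quotient.mk (Ideal.span (Set.range (adaptedForm b l)))
        (∑ t, rename Sum.inr (c t) * ∏ i ∈ t, fibreVar K i) = Ideal.Quotient.mk _ p := by
      rw [map_sum, hc]
    have h3 := Ideal.Quotient.eq.mp h1.symm
    refine Submodule.mem_sup.mpr ⟨_, sum_mem fun t _ =>
      rename_mul_prod_mem_restrictSupport (c t) t, _, h3, by ring⟩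

/-- A relation over the base ring is a squarefree combination lying in the ideal, hence zero as a
polynomial, hence has zero coefficients. -/
theorem exists_basis_adaptedForm_quotient (h2 : (2 : K) ≠ 0) (hb0 : b 3 ≠ 0)
    (hb1 : b 3 ^ 2 ≠ 1) (hl : l ≠ 0) :
    ∃ B : Module.Basis (Finset (Fin 4)) (MvPolynomial (Fin 4) K)
      (_ ⧸ Ideal.span (Set.range (adaptedForm b l))),
      ∀ t, B t = Ideal.Quotient.mk _ (∏ i ∈ t, fibreVar K i) := by
  have hli : LinearIndependent (MvPolynomial (Fin 4) K) (fun t : Finset (Fin 4) =>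
      Ideal.Quotient.mk (Ideal.span (Set.range (adaptedForm b l))) (∏ i ∈ t, fibreVar K i)) := by
    rw [Fintype.linearIndependent_iff]
    intro c hc
    simp only [base_smul_mk] at hc
    have h1 : Ideal.Quotient.mk (Ideal.span (Set.range (adaptedForm b l)))
        (∑ t, rename Sum.inr (c t) * ∏ i ∈ t, fibreVar K i) = 0 := by
      rw [map_sum, hc]
    have h3 := Ideal.Quotient.eq_zero_iff_mem.mp h1
    exact congrFun (eq_zero_of_sum_rename_mul_prod c
      (eq_zero_of_mem_restrictSupport_of_mem_span Sum.inl_injective (isHomogeneous_adaptedForm b l)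
        (adaptedForm_squarefreeSupport_sup_span b l h2 hb0 hb1 hl)
        (sum_mem fun t _ => rename_mul_prod_mem_restrictSupport (c t) t) h3))
  refine ⟨Module.Basis.mk hli (adaptedForm_quotient_span_eq_top b l h2 hb0 hb1 hl).ge, fun t => ?_⟩
  rw [Module.Basis.mk_apply]

end

/-! ### Fibres with sixteen points. -/

/-- The equations of the fibre of the linear projection over a point `p`, for a point `x`. -/
def IsFibrePoint {K : Type*} [Field K] (b : Fin 4 → K) (l : K) (p x : Fin 4 → K) : Prop :=
  x 0 ^ 2 = x 3 ^ 2 + p 1 ^ 2 - 2 * b 0 * x 3 * p 1 ∧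
  x 1 ^ 2 = p 1 ^ 2 + p 2 ^ 2 - 2 * b 1 * p 1 * p 2 ∧
  x 2 ^ 2 = p 2 ^ 2 + (l * x 3 + p 3) ^ 2 - 2 * b 2 * p 2 * (l * x 3 + p 3) ∧
  (x 0 + x 1 + x 2) ^ 2 = (l * x 3 + p 3) ^ 2 + x 3 ^ 2 - 2 * b 3 * (l * x 3 + p 3) * x 3

theorem Polynomial.exists_forall_eval_ne_zero {K : Type*} [Field K] [Infinite K]
    (S : List (Polynomial K)) (hS : ∀ q ∈ S, q ≠ 0) : ∃ a : K, ∀ q ∈ S, q.eval a ≠ 0 := by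
  classical
  obtain ⟨a, ha⟩ := Infinite.exists_notMem_finset S.prod.roots.toFinset
  refine ⟨a, fun q hq h0 => ha ?_⟩
  have hne : S.prod ≠ 0 := List.prod_ne_zero fun h => hS 0 h rfl
  rw [Multiset.mem_toFinset, Polynomial.mem_roots hne, Polynomial.IsRoot.def]
  exact zero_dvd_iff.mp (h0 ▸ Polynomial.eval_dvd (List.dvd_prod hq))

/-- The sign attached to a boolean. -/
def boolSign (K : Type*) [Field K] (e : Bool) : K := if e then 1 else -1

theorem boolSign_sq {K : Type*} [Field K] (e : Bool) : boolSign K e ^ 2 = 1 := by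
  cases e <;> simp [boolSign]

theorem boolSign_ne_zero {K : Type*} [Field K] (e : Bool) : boolSign K e ≠ 0 := by
  cases e <;> simp [boolSign]

theorem boolSign_injective {K : Type*} [Field K] (h2 : (2 : K) ≠ 0) :
    Function.Injective (boolSign K) := by
  have h1 : (1 : K) ≠ -1 := fun h => h2 (by linear_combination h)
  intro e e' h
  cases e <;> cases e' <;> simp_all [boolSign, eq_comm]

theorem Cubic.exists_injective_roots {K : Type*} [Field K] [IsAlgClosed K] (P : Cubic K)
    (ha : P.a ≠ 0) (hd : P.discr ≠ 0) :
    ∃ r : Fin 3 → K, Function.Injective r ∧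
      ∀ i, P.a * r i ^ 3 + P.b * r i ^ 2 + P.c * r i + P.d = 0 := by
  obtain ⟨x, y, z, h3⟩ := (Cubic.splits_iff_roots_eq_three (φ := RingHom.id K) ha).mp
    (IsAlgClosed.splits _)
  obtain ⟨hxy, hxz, hyz⟩ := (Cubic.discr_ne_zero_iff_roots_ne ha h3).mp hd
  have hP : (Cubic.map (RingHom.id K) P).toPoly ≠ 0 :=
    Cubic.ne_zero_of_a_ne_zero (by simpa [Cubic.map] using ha)
  have hroot : ∀ w ∈ (Cubic.map (RingHom.id K) P).roots,
      P.a * w ^ 3 + P.b * w ^ 2 + P.c * w + P.d = 0 := fun w hw =>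
    (Cubic.mem_roots_iff hP w).mp hw
  rw [h3] at hroot
  refine ⟨![x, y, z], ?_, ?_⟩
  · intro i j hij
    fin_cases i <;> fin_cases j <;> simp_all
  · intro i
    fin_cases i
    · exact hroot x (by simp)
    · exact hroot y (by simp)
    · exact hroot z (by simp)

theorem Cubic.eval_discr {K : Type*} [Field K] (P : Cubic (Polynomial K)) (a : K) :
    P.discr.eval a = (P.map (Polynomial.evalRingHom a)).discr := by
  simp [Cubic.discr, Cubic.map]

theorem exists_injective_quadratic_roots {K : Type*} [Field K] [IsAlgClosed K] (h2 : (2 : K) ≠ 0)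
    {a b c : K} (ha : a ≠ 0) (hd : b ^ 2 - a * c ≠ 0) :
    ∃ r : Bool → K, Function.Injective r ∧ ∀ i, a * r i ^ 2 + 2 * b * r i + c = 0 := by
  obtain ⟨s, hs⟩ := IsAlgClosed.exists_pow_nat_eq (b ^ 2 - a * c) (n := 2) (by norm_num)
  have hs0 : s ≠ 0 := by
    rintro rfl
    exact hd (by rw [← hs]; ring)
  refine ⟨fun i => (-b + boolSign K i * s) / a, fun i j hij => ?_, fun i => ?_⟩
  · have h1 : -b + boolSign K i * s = -b + boolSign K j * s := by
      simpa [div_left_inj' ha] using hij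
    exact boolSign_injective h2 (mul_right_cancel₀ hs0 (add_left_cancel h1))
  · field_simp
    linear_combination s ^ 2 * boolSign_sq (K := K) i + hs

/-- A fibre with sixteen points when the first and the last coefficient differ up to sign. -/
theorem exists_fibre_of_ne {K : Type*} [Field K] [IsAlgClosed K] (h2 : (2 : K) ≠ 0)
    (b : Fin 4 → K) (h0 : b 0 ^ 2 ≠ 1) (h3 : b 3 ^ 2 ≠ 1) (h03 : b 3 ^ 2 ≠ b 0 ^ 2) :
    ∃ l : K, l ≠ 0 ∧ ∃ p : Fin 4 → K, ∃ x : Bool × Bool × Fin 4 → Fin 4 → K,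
      Function.Injective x ∧ ∀ i, IsFibrePoint b l p (x i) := by
  have : Infinite K := IsAlgClosed.instInfinite
  -- The fibre is taken over `(0, 1, 0, d)`. The excluded values keep `d` and the leading
  -- coefficients `1 ± d` of the cubics below nonzero, and make their discriminants nonzero at `l =
  -- 0`.
  obtain ⟨d, hd⟩ := Infinite.exists_notMem_finset (α := K) (by
    classical exact {0, 1, -1, (b 0 + 1) / (b 3 - 1), (b 0 + 1) / (b 3 + 1),
      (b 0 - 1) / (b 3 - 1), (b 0 - 1) / (b 3 + 1)})
  simp only [Finset.mem_insert, Finset.mem_singleton, not_or] at hd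
  obtain ⟨hd0, hd1, hd2, hd3, hd4, hd5, hd6⟩ := hd
  have h31 : b 3 - 1 ≠ 0 := fun h => h3 (by linear_combination (b 3 + 1) * h)
  have h32 : b 3 + 1 ≠ 0 := fun h => h3 (by linear_combination (b 3 - 1) * h)
  rw [eq_div_iff h31] at hd3 hd5
  rw [eq_div_iff h32] at hd4 hd6
  have ha : ∀ e, d * boolSign K e + 1 ≠ 0 := by
    intro e h
    cases e
    · exact hd1 (by simp [boolSign] at h; linear_combination -h)
    · exact hd2 (by simp [boolSign] at h; linear_combination h)
  have hdisc : ∀ e, (d * boolSign K e + 1) ^ 2 - (d * b 3 - b 0) ^ 2 ≠ 0 := by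
    intro e h
    cases e
    · simp only [boolSign] at h
      have : (d * (b 3 - 1) - (b 0 - 1)) * (d * (b 3 + 1) - (b 0 + 1)) = 0 := by
        simp at h; linear_combination -h
      rcases mul_eq_zero.mp this with h | h
      · exact hd5 (by linear_combination h)
      · exact hd4 (by linear_combination h)
    · simp only [boolSign] at h
      have : (d * (b 3 - 1) - (b 0 + 1)) * (d * (b 3 + 1) - (b 0 - 1)) = 0 := by
        simp at h; linear_combination -h
      rcases mul_eq_zero.mp this with h | h
      · exact hd3 (by linear_combination h)
      · exact hd6 (by linear_combination h)
  -- Over `(0, 1, 0, d)` the second and third equations give `x 1 = g` and `x 2 = g * e * (l * z +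
  -- d)` with signs `g, e` and `z = x 3`. Writing `x 0 = g * (T - 1)` leaves two conics in `(z, T)`
  -- through the origin; on the line `T = r * z` their other intersections with it coincide exactly
  -- when `r` is a root of this cubic. Its coefficients are polynomials in `l`.
  let P : Bool → Cubic (Polynomial K) := fun e =>
    ⟨.C (d * boolSign K e + 1), .C (d * b 3 - b 0) + .C (2 * boolSign K e) * .X,
      .C (-(d * boolSign K e + 1)) + .C (2 * (b 3 - boolSign K e * b 0)) * .X,
      .C (-(d * b 3 - b 0)) - .C (2 * b 3 * b 0) * .X⟩
  have hPl : ∀ e l, (P e).map (Polynomial.evalRingHom l) = ⟨d * boolSign K e + 1,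
      d * b 3 - b 0 + 2 * boolSign K e * l,
      -(d * boolSign K e + 1) + 2 * (b 3 - boolSign K e * b 0) * l,
      -(d * b 3 - b 0) - 2 * b 3 * b 0 * l⟩ := by
    intro e l
    simp [P, Cubic.map]
  generalize P = P at hPl
  have hP : ∀ e, (P e).discr ≠ 0 := by
    intro e h
    have h1 := congrArg (Polynomial.eval 0) h
    rw [Cubic.eval_discr, hPl, Polynomial.eval_zero] at h1
    simp only [Cubic.discr] at h1
    -- At `l = 0` the cubic is `(r ^ 2 - 1) * ((d * e + 1) * r + (d * b 3 - b 0))`, with `e` the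
    -- sign, and this is its discriminant.
    have h4 : 2 ^ 2 * ((d * boolSign K e + 1) ^ 2 - (d * b 3 - b 0) ^ 2) ^ 2 = 0 := by
      linear_combination h1
    exact mul_ne_zero (pow_ne_zero 2 h2) (pow_ne_zero 2 (hdisc e)) h4
  obtain ⟨l, hl⟩ := Polynomial.exists_forall_eval_ne_zero (K := K)
    [.X, (P true).discr, (P false).discr] (by simp [hP])
  simp only [List.mem_cons, List.not_mem_nil, or_false, forall_eq_or_imp, forall_eq,
    Polynomial.eval_X] at hl
  obtain ⟨hl0, hlt, hlf⟩ := hl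
  have hr : ∀ e, ∃ r : Fin 3 → K, Function.Injective r ∧ ∀ i,
      d * (boolSign K e * r i + b 3) * (r i ^ 2 - 1) + (r i - b 0) * (r i ^ 2 - 1) +
        2 * l * (boolSign K e * r i + b 3) * (r i - b 0) = 0 := by
    intro e
    have hdl : ((P e).map (Polynomial.evalRingHom l)).discr ≠ 0 := by
      rw [← Cubic.eval_discr]
      exact Bool.rec hlf hlt e
    rw [hPl] at hdl
    obtain ⟨r, hri, hr⟩ := Cubic.exists_injective_roots _ (ha e) hdl
    exact ⟨r, hri, fun i => by linear_combination hr i⟩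
  choose r hri hr using hr
  have hr1 : ∀ e i, r e i ^ 2 - 1 ≠ 0 := by
    intro e i h
    have he := boolSign_sq (K := K) e
    have h5 : 2 * l * ((boolSign K e * r e i + b 3) * (r e i - b 0)) = 0 := by
      linear_combination hr e i - (d * (boolSign K e * r e i + b 3) + (r e i - b 0)) * h
    rcases mul_eq_zero.mp ((mul_eq_zero.mp h5).resolve_left (mul_ne_zero h2 hl0)) with h6 | h6
    · exact h3 (by linear_combination (b 3 - boolSign K e * r e i) * h6 + r e i ^ 2 * he + h)
    · exact h0 (by linear_combination h - (r e i + b 0) * h6)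
  have hr2 : ∀ e i, r e i - b 0 ≠ 0 := by
    intro e i h
    have he := boolSign_sq (K := K) e
    have h5 : d * ((boolSign K e * r e i + b 3) * (r e i ^ 2 - 1)) = 0 := by
      linear_combination hr e i - (2 * l * (boolSign K e * r e i + b 3) + (r e i ^ 2 - 1)) * h
    have h6 := (mul_eq_zero.mp ((mul_eq_zero.mp h5).resolve_left hd0)).resolve_right (hr1 e i)
    exact h03 (by linear_combination (b 3 - boolSign K e * r e i) * h6 + r e i ^ 2 * he +
      (r e i + b 0) * h)
  -- Four points for each choice of signs: the origin `z = T = 0` and one point for each of the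
  -- three slopes `r`.
  let z : Bool → Fin 4 → K := fun e => Fin.cons 0 fun i => 2 * (r e i - b 0) / (r e i ^ 2 - 1)
  let T : Bool → Fin 4 → K := fun e => Fin.cons 0 fun i => r e i * z e i.succ
  have hz : ∀ e i, z e (Fin.succ i) * (r e i ^ 2 - 1) = 2 * (r e i - b 0) := fun e i =>
    div_mul_cancel₀ _ (hr1 e i)
  have hy : ∀ e i, r e i - b 0 = -(l * z e (Fin.succ i) + d) * (boolSign K e * r e i + b 3) := by
    intro e i
    refine mul_left_cancel₀ (hr1 e i) ?_
    linear_combination hr e i + l * (boolSign K e * r e i + b 3) * hz e i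
  refine ⟨l, hl0, ![0, 1, 0, d], fun i => ![boolSign K i.1 * (T i.2.1 i.2.2 - 1), boolSign K i.1,
    boolSign K i.1 * boolSign K i.2.1 * (l * z i.2.1 i.2.2 + d), z i.2.1 i.2.2], ?_, ?_⟩
  · rintro ⟨g, e, i⟩ ⟨g', e', i'⟩ h
    have k0 := congrFun h 0
    have k1 := congrFun h 1
    have k2 := congrFun h 2
    have k3 := congrFun h 3
    simp only [Matrix.cons_val] at k0 k1 k2 k3
    obtain rfl := boolSign_injective h2 k1
    have hy0 : ∀ e i, l * z e i + d ≠ 0 := by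
      intro e i
      refine Fin.cases ?_ (fun i => ?_) i
      · simpa [z] using hd0
      · intro h
        apply hr2 e i
        rw [hy, h]; ring
    rw [k3] at k2
    obtain rfl := boolSign_injective h2
      (mul_left_cancel₀ (boolSign_ne_zero g) (mul_right_cancel₀ (hy0 e' i') k2))
    have hT : T e i = T e i' := by
      have := mul_left_cancel₀ (boolSign_ne_zero g) k0
      linear_combination this
    have hz0 : ∀ i, z e (Fin.succ i) ≠ 0 := fun i h =>
      mul_ne_zero h2 (hr2 e i) (by rw [← hz, h, zero_mul])
    suffices i = i' by rw [this]
    revert k3 hT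
    clear k0 k2 h
    refine Fin.cases ?_ (fun i => ?_) i <;> refine Fin.cases ?_ (fun i' => ?_) i'
    · intros; rfl
    · intro h; exact absurd h.symm (hz0 i')
    · intro h; exact absurd h (hz0 i)
    · intro h hT
      have : r e i * z e i.succ = r e i' * z e i'.succ := hT
      rw [h] at this
      rw [hri e (mul_right_cancel₀ (hz0 i') this)]
  · rintro ⟨g, e, i⟩
    have hg := boolSign_sq (K := K) g
    have he := boolSign_sq (K := K) e
    have key : (T e i - 1) ^ 2 = z e i ^ 2 + 1 - 2 * b 0 * z e i ∧
        (T e i + boolSign K e * (l * z e i + d)) ^ 2 =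
          (l * z e i + d) ^ 2 + z e i ^ 2 - 2 * b 3 * (l * z e i + d) * z e i := by
      refine Fin.cases ?_ (fun i => ?_) i
      · simp [T, z, mul_pow, he]
      · have hT : T e i.succ = r e i * z e i.succ := rfl
        rw [hT]
        constructor
        · linear_combination z e i.succ * hz e i
        · linear_combination z e i.succ * hz e i + (l * z e i.succ + d) ^ 2 * he +
            2 * z e i.succ * hy e i
    obtain ⟨key0, key3⟩ := key
    refine ⟨?_, ?_, ?_, ?_⟩ <;> simp only [Matrix.cons_val]
    · linear_combination (T e i - 1) ^ 2 * hg + key0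
    · linear_combination hg
    · linear_combination (l * z e i + d) ^ 2 * boolSign K e ^ 2 * hg + (l * z e i + d) ^ 2 * he
    · linear_combination (T e i + boolSign K e * (l * z e i + d)) ^ 2 * hg + key3

/-- A fibre with sixteen points when the first and the third coefficient agree. -/
theorem exists_fibre_of_eq {K : Type*} [Field K] [IsAlgClosed K] (h2 : (2 : K) ≠ 0)
    (b : Fin 4 → K) (h0 : b 0 ^ 2 ≠ 1) (h1 : b 1 ^ 2 ≠ 1) (h3 : b 3 ^ 2 ≠ 1) (h02 : b 2 = b 0) :
    ∃ l : K, l ≠ 0 ∧ ∃ p : Fin 4 → K, ∃ x : Bool × Bool × Bool × Bool → Fin 4 → K,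
      Function.Injective x ∧ ∀ i, IsFibrePoint b l p (x i) := by
  have : Infinite K := IsAlgClosed.instInfinite
  -- The fibre is taken over `(0, 1, l, 0)`. Since `b 2 = b 0`, the third right-hand side is then `l
  -- ^ 2` times the first, so `x 2 = σ * l * x 0` for a sign `σ`. The squares of `x 1` and of `(x 0
  -- + x 1 + x 2) / x 3` become the constants `α` and `γ`, evaluated at `l`.
  let α : Polynomial K := 1 + .X ^ 2 - .C (2 * b 1) * .X
  let γ : Polynomial K := 1 + .X ^ 2 - .C (2 * b 3) * .X
  let μ : Bool → Polynomial K := fun σ => (1 + .C (boolSign K σ) * .X) ^ 2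
  have eα : ∀ a, α.eval a = 1 + a ^ 2 - 2 * b 1 * a := fun a => by simp [α]
  have eγ : ∀ a, γ.eval a = 1 + a ^ 2 - 2 * b 3 * a := fun a => by simp [γ]
  have eμ : ∀ σ a, (μ σ).eval a = (1 + boolSign K σ * a) ^ 2 := fun σ a => by simp [μ]
  -- Nonvanishing of `ω` ensures `x 0 ≠ 0`; `δ σ` is the product over the sign `e` of the
  -- discriminants, up to a factor `4`, of the quadratic equations for `x 3`. At `l = 0` these are
  -- `4 * (1 - b 0 ^ 2)` and `(1 - b 0 ^ 2) ^ 2`.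
  let ω : Polynomial K := (α + γ) ^ 2 - .C (4 * b 0 ^ 2) * α * γ
  let δ : Bool → Polynomial K := fun σ =>
    (α * γ + .C (b 0 ^ 2) * μ σ ^ 2 - (γ - μ σ) * (α - μ σ)) ^ 2 -
      .C (4 * b 0 ^ 2) * α * γ * μ σ ^ 2
  have hne : ∀ q : Polynomial K, q.eval 0 ≠ 0 → q ≠ 0 := by
    rintro q h rfl
    simp at h
  have hb : 1 - b 0 ^ 2 ≠ 0 := fun h => h0 (by linear_combination -h)
  obtain ⟨l, hl⟩ := Polynomial.exists_forall_eval_ne_zero (K := K)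
    [.X, α, γ, μ true, μ false, ω, δ true, δ false] (by
      simp only [List.mem_cons, List.not_mem_nil, or_false, forall_eq_or_imp, forall_eq]
      refine ⟨Polynomial.X_ne_zero, hne _ (by simp [eα]), hne _ (by simp [eγ]),
        hne _ (by simp [eμ]), hne _ (by simp [eμ]), hne _ ?_, hne _ ?_, hne _ ?_⟩
      · simp only [ω, Polynomial.eval_sub, Polynomial.eval_mul, Polynomial.eval_pow,
          Polynomial.eval_add, Polynomial.eval_C, eα, eγ]
        intro h
        exact mul_ne_zero (pow_ne_zero 2 h2) hb (by linear_combination h)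
      all_goals
        simp only [δ, Polynomial.eval_sub, Polynomial.eval_mul, Polynomial.eval_pow,
          Polynomial.eval_add, Polynomial.eval_C, eα, eγ, eμ]
        intro h
        exact pow_ne_zero 2 hb (by linear_combination h))
  simp only [List.mem_cons, List.not_mem_nil, or_false, forall_eq_or_imp, forall_eq,
    Polynomial.eval_X, eα, eγ, eμ] at hl
  obtain ⟨hl0, hα, hγ, hμt, hμf, hω, hδt, hδf⟩ := hl
  simp only [ω, δ, Polynomial.eval_sub, Polynomial.eval_mul, Polynomial.eval_pow,
    Polynomial.eval_add, Polynomial.eval_C, eα, eγ, eμ] at hω hδt hδf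
  have hμ : ∀ σ, 1 + boolSign K σ * l ≠ 0 := by
    intro σ h
    cases σ
    · exact hμf (by rw [h]; ring)
    · exact hμt (by rw [h]; ring)
  obtain ⟨A, hA⟩ := IsAlgClosed.exists_pow_nat_eq (1 + l ^ 2 - 2 * b 1 * l) (n := 2) (by norm_num)
  obtain ⟨B, hB⟩ := IsAlgClosed.exists_pow_nat_eq (1 + l ^ 2 - 2 * b 3 * l) (n := 2) (by norm_num)
  rw [← hA, ← hB] at hω hδt hδf
  rw [← hA] at hα
  rw [← hB] at hγ
  have hA0 : A ≠ 0 := fun h => hα (by rw [h]; ring)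
  have hB0 : B ≠ 0 := fun h => hγ (by rw [h]; ring)
  have hδ : ∀ σ, (A ^ 2 * B ^ 2 + b 0 ^ 2 * ((1 + boolSign K σ * l) ^ 2) ^ 2 -
      (B ^ 2 - (1 + boolSign K σ * l) ^ 2) * (A ^ 2 - (1 + boolSign K σ * l) ^ 2)) ^ 2 -
      4 * b 0 ^ 2 * A ^ 2 * B ^ 2 * ((1 + boolSign K σ * l) ^ 2) ^ 2 ≠ 0 := by
    intro σ
    cases σ <;> assumption
  have hsq : ∀ (c : K) σ, c ^ 2 ≠ 1 → c + boolSign K σ ≠ 0 := by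
    intro c σ hc h
    exact hc (by linear_combination (c - boolSign K σ) * h + boolSign_sq (K := K) σ)
  -- With `x 1 = g * A`, the last equation reads `(1 + σ * l) * x 0 = g * (e * B * z - A)` for a
  -- sign `e`. Squaring and inserting the first equation gives this quadratic equation for `z = x
  -- 3`; two roots for each of `g, σ, e` make sixteen points.
  have hr : ∀ σ e, ∃ r : Bool → K, Function.Injective r ∧ ∀ i,
      (boolSign K e * B * r i - A) ^ 2 =
        (1 + boolSign K σ * l) ^ 2 * (1 + r i ^ 2 - 2 * b 0 * r i) := by
    intro σ e
    have hs := boolSign_sq (K := K) σ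
    have he := boolSign_sq (K := K) e
    obtain ⟨r, hri, hr⟩ := exists_injective_quadratic_roots h2
      (a := B ^ 2 - (1 + boolSign K σ * l) ^ 2)
      (b := -(boolSign K e * A * B) + b 0 * (1 + boolSign K σ * l) ^ 2)
      (c := A ^ 2 - (1 + boolSign K σ * l) ^ 2)
      (by
        rw [hB]
        intro h
        exact mul_ne_zero (mul_ne_zero h2 hl0) (hsq _ σ h3)
          (by linear_combination -h - l ^ 2 * hs))
      (by
        intro h
        apply hδ σ
        linear_combination (A ^ 2 * B ^ 2 + b 0 ^ 2 * ((1 + boolSign K σ * l) ^ 2) ^ 2 -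
          (B ^ 2 - (1 + boolSign K σ * l) ^ 2) * (A ^ 2 - (1 + boolSign K σ * l) ^ 2) +
          2 * boolSign K e * A * B * b 0 * (1 + boolSign K σ * l) ^ 2) * (h - A ^ 2 * B ^ 2 * he) +
          4 * b 0 ^ 2 * A ^ 2 * B ^ 2 * ((1 + boolSign K σ * l) ^ 2) ^ 2 * he)
    refine ⟨r, hri, fun i => ?_⟩
    linear_combination hr i + B ^ 2 * r i ^ 2 * he
  choose r hri hr using hr
  have hz0 : ∀ σ e i, r σ e i ≠ 0 := by
    intro σ e i h
    have h4 := hr σ e i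
    rw [h] at h4
    refine mul_ne_zero (mul_ne_zero h2 hl0) (hsq _ σ h1) ?_
    linear_combination -h4 + hA - l ^ 2 * boolSign_sq (K := K) σ
  have hw0 : ∀ σ e i, boolSign K e * B * r σ e i - A ≠ 0 := by
    intro σ e i h
    have h4 := hr σ e i
    rw [h, zero_pow two_ne_zero] at h4
    have h5 := (mul_eq_zero.mp h4.symm).resolve_left (pow_ne_zero 2 (hμ σ))
    have he := boolSign_sq (K := K) e
    apply hω
    have h6 : B ^ 2 * r σ e i ^ 2 = A ^ 2 := by
      linear_combination (boolSign K e * B * r σ e i + A) * h - B ^ 2 * r σ e i ^ 2 * he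
    have h7 : A ^ 2 + B ^ 2 = 2 * b 0 * B ^ 2 * r σ e i := by
      linear_combination B ^ 2 * h5 - h6
    rw [h7]
    linear_combination 4 * b 0 ^ 2 * B ^ 2 * h6
  refine ⟨l, hl0, ![0, 1, l, 0], fun i => ![boolSign K i.1 *
    ((boolSign K i.2.2.1 * B * r i.2.1 i.2.2.1 i.2.2.2 - A) / (1 + boolSign K i.2.1 * l)),
    boolSign K i.1 * A, boolSign K i.2.1 * l * (boolSign K i.1 *
    ((boolSign K i.2.2.1 * B * r i.2.1 i.2.2.1 i.2.2.2 - A) / (1 + boolSign K i.2.1 * l))),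
    r i.2.1 i.2.2.1 i.2.2.2], ?_, ?_⟩
  · rintro ⟨g, σ, e, i⟩ ⟨g', σ', e', i'⟩ h
    have k0 := congrFun h 0
    have k1 := congrFun h 1
    have k2 := congrFun h 2
    have k3 := congrFun h 3
    simp only [Matrix.cons_val] at k0 k1 k2 k3
    obtain rfl := boolSign_injective h2 (mul_right_cancel₀ hA0 k1)
    rw [k0] at k2
    obtain rfl := boolSign_injective h2 (mul_right_cancel₀ hl0 (mul_right_cancel₀
      (mul_ne_zero (boolSign_ne_zero g) (div_ne_zero (hw0 σ' e' i') (hμ σ'))) k2))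
    have k4 := (div_left_inj' (hμ σ)).mp (mul_left_cancel₀ (boolSign_ne_zero g) k0)
    rw [k3] at k4
    have he : boolSign K e * (B * r σ e' i') = boolSign K e' * (B * r σ e' i') := by
      linear_combination k4
    obtain rfl := boolSign_injective h2 (mul_right_cancel₀ (mul_ne_zero hB0 (hz0 σ e' i')) he)
    rw [hri σ e k3]
  · rintro ⟨g, σ, e, i⟩
    have hg := boolSign_sq (K := K) g
    have hs := boolSign_sq (K := K) σ
    have he := boolSign_sq (K := K) e
    have hdiv : ((boolSign K e * B * r σ e i - A) / (1 + boolSign K σ * l)) ^ 2 =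
        1 + r σ e i ^ 2 - 2 * b 0 * r σ e i := by
      rw [div_pow, hr, mul_div_cancel_left₀ _ (pow_ne_zero 2 (hμ σ))]
    have hmul := div_mul_cancel₀ (boolSign K e * B * r σ e i - A) (hμ σ)
    set v := (boolSign K e * B * r σ e i - A) / (1 + boolSign K σ * l)
    refine ⟨?_, ?_, ?_, ?_⟩ <;> simp only [Matrix.cons_val]
    · linear_combination v ^ 2 * hg + hdiv
    · linear_combination A ^ 2 * hg + hA
    · rw [h02]
      linear_combination boolSign K σ ^ 2 * l ^ 2 * v ^ 2 * hg + l ^ 2 * v ^ 2 * hs + l ^ 2 * hdiv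
    · have : boolSign K g * v + boolSign K g * A + boolSign K σ * l * (boolSign K g * v) =
          boolSign K g * (boolSign K e * B * r σ e i) := by linear_combination boolSign K g * hmul
      rw [this]
      linear_combination boolSign K e ^ 2 * B ^ 2 * r σ e i ^ 2 * hg + B ^ 2 * r σ e i ^ 2 * he +
        r σ e i ^ 2 * hB

/-- Some fibre of the linear projection has sixteen points. -/
theorem exists_fibre {K : Type*} [Field K] [IsAlgClosed K] (h2 : (2 : K) ≠ 0)
    (b : Fin 4 → K) (h0 : b 0 ^ 2 ≠ 1) (h1 : b 1 ^ 2 ≠ 1) (h3 : b 3 ^ 2 ≠ 1)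
    (h02 : b 3 ^ 2 = b 0 ^ 2 → b 2 = b 0) :
    ∃ l : K, l ≠ 0 ∧ ∃ p : Fin 4 → K, ∃ x : Finset (Fin 4) → Fin 4 → K,
      Function.Injective x ∧ ∀ t, IsFibrePoint b l p (x t) := by
  by_cases h03 : b 3 ^ 2 = b 0 ^ 2
  · obtain ⟨l, hl, p, x, hx, h⟩ := exists_fibre_of_eq h2 b h0 h1 h3 (h02 h03)
    let e : Finset (Fin 4) ≃ Bool × Bool × Bool × Bool := Fintype.equivOfCardEq (by simp)
    exact ⟨l, hl, p, x ∘ e, hx.comp e.injective, fun t => h (e t)⟩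
  · obtain ⟨l, hl, p, x, hx, h⟩ := exists_fibre_of_ne h2 b h0 h3 h03
    let e : Finset (Fin 4) ≃ Bool × Bool × Fin 4 := Fintype.equivOfCardEq (by simp)
    exact ⟨l, hl, p, x ∘ e, hx.comp e.injective, fun t => h (e t)⟩

/-! ### Radicality, and return to the scaled coordinates. -/

section

attribute [local instance] baseAlgebra

/-- The points of the fibre are ring homomorphisms from the quotient to `K` that agree on the base
ring. Their number is the rank, so the quotient is reduced. -/
theorem isRadical_span_adaptedForm {K : Type*} [Field K] (b : Fin 4 → K) (l : K)
    (h2 : (2 : K) ≠ 0) (hb0 : b 3 ≠ 0) (hb1 : b 3 ^ 2 ≠ 1) (hl : l ≠ 0) (p : Fin 4 → K)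
    (x : Finset (Fin 4) → Fin 4 → K) (hx : Function.Injective x)
    (h : ∀ t, IsFibrePoint b l p (x t)) :
    (Ideal.span (Set.range (adaptedForm b l))).IsRadical := by
  obtain ⟨B, -⟩ := exists_basis_adaptedForm_quotient b l h2 hb0 hb1 hl
  rw [Ideal.isRadical_iff_quotient_reduced]
  have hv : ∀ t, ∀ g ∈ Ideal.span (Set.range (adaptedForm b l)),
      eval (Sum.elim (x t) p) g = 0 := by
    intro t
    have hle : Ideal.span (Set.range (adaptedForm b l)) ≤
        RingHom.ker (eval (Sum.elim (x t) p)) := by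
      rw [Ideal.span_le]
      rintro _ ⟨k, rfl⟩
      obtain ⟨h0, h1, h2, h3⟩ := h t
      rw [SetLike.mem_coe, RingHom.mem_ker]
      fin_cases k <;> simp [adaptedForm, conicForm]
      · linear_combination h0
      · linear_combination h1
      · linear_combination h2
      · linear_combination h3
    exact fun g hg => hle hg
  refine isReduced_of_injective_fiber B (eval p)
    (fun t => Ideal.Quotient.lift _ (eval (Sum.elim (x t) p)) (hv t)) ?_ ?_
  · intro t t' h
    refine hx (funext fun i => ?_)
    have := RingHom.congr_fun h (Ideal.Quotient.mk _ (fibreVar K i))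
    simpa using this
  · intro t g
    change Ideal.Quotient.lift _ (eval (Sum.elim (x t) p)) (hv t)
      (Ideal.Quotient.mk _ (rename Sum.inr g)) = _
    rw [Ideal.Quotient.lift_mk, eval_rename, Sum.elim_comp_inr]

end

/-- The four quadratic forms with scaled coordinates. -/
noncomputable def scaledForm {K : Type*} [Field K] (s b : Fin 4 → K) :
    Fin 4 → MvPolynomial (Fin (7 + 1)) K :=
  ![conicForm (2 * b 0) (X 0) (C (s 0) * X 4) (C (s 1) * X 5),
    conicForm (2 * b 1) (X 1) (C (s 1) * X 5) (C (s 2) * X 6),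
    conicForm (2 * b 2) (X 2) (C (s 2) * X 6) (C (s 3) * X 7),
    conicForm (2 * b 3) (X 0 + X 1 + X 2) (C (s 3) * X 7) (C (s 0) * X 4)]

theorem isHomogeneous_scaledForm {K : Type*} [Field K] (s b : Fin 4 → K) (k : Fin 4) :
    (scaledForm s b k).IsHomogeneous 2 := by
  have hX : ∀ i, (X i : MvPolynomial (Fin (7 + 1)) K).IsHomogeneous 1 := isHomogeneous_X K
  fin_cases k
  · exact isHomogeneous_conicForm _ (hX _) ((hX _).C_mul _) ((hX _).C_mul _)
  · exact isHomogeneous_conicForm _ (hX _) ((hX _).C_mul _) ((hX _).C_mul _)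
  · exact isHomogeneous_conicForm _ (hX _) ((hX _).C_mul _) ((hX _).C_mul _)
  · exact isHomogeneous_conicForm _ (((hX _).add (hX _)).add (hX _)) ((hX _).C_mul _)
      ((hX _).C_mul _)

/-- The images of the scaled coordinates in the adapted coordinates. -/
noncomputable def toAdapted {K : Type*} [Field K] (s : Fin 4 → K) (l : K) :
    Fin (7 + 1) → MvPolynomial (Fin 4 ⊕ Fin 4) K :=
  ![fibreVar K 0, fibreVar K 1, fibreVar K 2, baseVar K 0, C (s 0)⁻¹ * fibreVar K 3,
    C (s 1)⁻¹ * baseVar K 1, C (s 2)⁻¹ * baseVar K 2,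
    C (s 3)⁻¹ * (C l * fibreVar K 3 + baseVar K 3)]

/-- The images of the adapted coordinates in the scaled coordinates. -/
noncomputable def ofAdapted {K : Type*} [Field K] (s : Fin 4 → K) (l : K) :
    Fin 4 ⊕ Fin 4 → MvPolynomial (Fin (7 + 1)) K :=
  Sum.elim ![X 0, X 1, X 2, C (s 0) * X 4]
    ![X 3, C (s 1) * X 5, C (s 2) * X 6, C (s 3) * X 7 - C l * (C (s 0) * X 4)]

theorem C_mul_C_inv_mul {σ K : Type*} [Field K] {a : K} (ha : a ≠ 0) (p : MvPolynomial σ K) :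
    C a * (C a⁻¹ * p) = p := by
  rw [← mul_assoc, ← C_mul, mul_inv_cancel₀ ha, C_1, one_mul]

theorem C_inv_mul_C_mul {σ K : Type*} [Field K] {a : K} (ha : a ≠ 0) (p : MvPolynomial σ K) :
    C a⁻¹ * (C a * p) = p := by
  rw [← mul_assoc, ← C_mul, inv_mul_cancel₀ ha, C_1, one_mul]

/-- The linear change of coordinates. -/
noncomputable def adaptedEquiv {K : Type*} [Field K] (s : Fin 4 → K) (hs : ∀ i, s i ≠ 0) (l : K) :
    MvPolynomial (Fin (7 + 1)) K ≃ₐ[K] MvPolynomial (Fin 4 ⊕ Fin 4) K :=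
  AlgEquiv.ofAlgHom (aeval (toAdapted s l)) (aeval (ofAdapted s l))
    (by
      refine MvPolynomial.algHom_ext fun i => ?_
      rcases i with i | i <;> fin_cases i <;>
        simp [ofAdapted, toAdapted, algHom_C, algebraMap_eq, C_mul_C_inv_mul (hs _)])
    (by
      refine MvPolynomial.algHom_ext fun i => ?_
      fin_cases i <;>
        simp [ofAdapted, toAdapted, algHom_C, algebraMap_eq, C_inv_mul_C_mul (hs _)])

theorem adaptedEquiv_scaledForm {K : Type*} [Field K] (s : Fin 4 → K) (hs : ∀ i, s i ≠ 0) (l : K)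
    (b : Fin 4 → K) (k : Fin 4) :
    adaptedEquiv s hs l (scaledForm s b k) = adaptedForm b l k := by
  change aeval (toAdapted s l) _ = _
  fin_cases k <;> simp [scaledForm, adaptedForm, conicForm, toAdapted, algHom_C, algebraMap_eq,
    C_mul_C_inv_mul (hs _)]

theorem isHomogeneous_ofAdapted {K : Type*} [Field K] (s : Fin 4 → K) (l : K) (i : Fin 4 ⊕ Fin 4) :
    (ofAdapted s l i).IsHomogeneous 1 := by
  have hX : ∀ i, (X i : MvPolynomial (Fin (7 + 1)) K).IsHomogeneous 1 := isHomogeneous_X K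
  rcases i with i | i <;> fin_cases i
  · exact hX 0
  · exact hX 1
  · exact hX 2
  · exact (hX 4).C_mul _
  · exact hX 3
  · exact (hX 5).C_mul _
  · exact (hX 6).C_mul _
  · exact ((hX 7).C_mul _).sub (((hX 4).C_mul _).C_mul _)

/-- A graded Noether normalization of the quotient by an ideal: the quotient is a graded free
module over a polynomial ring in `r` linear forms, with the given generators. -/
structure GradedNoetherNormalization {K : Type*} [Field K] {N : ℕ} (r : ℕ)
    (I : Ideal (MvPolynomial (Fin N) K)) (κ : Type*) [Fintype κ] where
  /-- The inclusion of the polynomial ring. -/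
  param : MvPolynomial (Fin r) K →ₐ[K] MvPolynomial (Fin N) K
  /-- The module generators. -/
  gen : κ → MvPolynomial (Fin N) K
  /-- The degrees of the generators. -/
  deg : κ → ℕ
  param_homogeneous : ∀ j, (param (X j)).IsHomogeneous 1
  gen_homogeneous : ∀ t, (gen t).IsHomogeneous (deg t)
  span : ∀ g, ∃ c : κ → MvPolynomial (Fin r) K, g - ∑ t, param (c t) * gen t ∈ I
  independent : ∀ c : κ → MvPolynomial (Fin r) K, ∑ t, param (c t) * gen t ∈ I → c = 0
  one : κ
  gen_one : gen one = 1

section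

attribute [local instance] baseAlgebra

theorem mem_span_scaledForm_iff {K : Type*} [Field K] (s : Fin 4 → K) (hs : ∀ i, s i ≠ 0)
    (b : Fin 4 → K) (l : K) (g : MvPolynomial (Fin (7 + 1)) K) :
    g ∈ Ideal.span (Set.range (scaledForm s b)) ↔
      adaptedEquiv s hs l g ∈ Ideal.span (Set.range (adaptedForm b l)) := by
  have h1 : Ideal.map (adaptedEquiv s hs l) (Ideal.span (Set.range (scaledForm s b))) =
      Ideal.span (Set.range (adaptedForm b l)) := by
    rw [Ideal.map_span, ← Set.range_comp]
    congr 2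
    exact funext (adaptedEquiv_scaledForm s hs l b)
  rw [← h1]
  refine ⟨Ideal.mem_map_of_mem _, fun h => ?_⟩
  obtain ⟨x, hx, hxg⟩ := (Ideal.mem_map_iff_of_surjective (adaptedEquiv s hs l)
    (adaptedEquiv s hs l).surjective).mp h
  rwa [← (adaptedEquiv s hs l).injective hxg]

/-- The graded Noether normalization of the quotient by the scaled forms. -/
noncomputable def scaledNormalization {K : Type*} [Field K] (s : Fin 4 → K) (hs : ∀ i, s i ≠ 0)
    (b : Fin 4 → K) (h2 : (2 : K) ≠ 0) (hb0 : b 3 ≠ 0) (hb1 : b 3 ^ 2 ≠ 1) {l : K} (hl : l ≠ 0) :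
    GradedNoetherNormalization 4 (Ideal.span (Set.range (scaledForm s b))) (Finset (Fin 4)) where
  param := (adaptedEquiv s hs l).symm.toAlgHom.comp (rename Sum.inr)
  gen t := (adaptedEquiv s hs l).symm (∏ i ∈ t, fibreVar K i)
  deg t := t.card
  param_homogeneous j := by
    rw [AlgHom.comp_apply, rename_X]
    change (aeval (ofAdapted s l) (X (Sum.inr j))).IsHomogeneous 1
    rw [aeval_X]
    exact isHomogeneous_ofAdapted s l _
  gen_homogeneous t := by
    rw [map_prod]
    have := IsHomogeneous.prod t (fun i => (adaptedEquiv s hs l).symm (fibreVar K i)) (fun _ => 1)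
      (fun i _ => by
        change (aeval (ofAdapted s l) (X (Sum.inl i))).IsHomogeneous 1
        rw [aeval_X]
        exact isHomogeneous_ofAdapted s l _)
    simpa using this
  span g := by
    have hg : Ideal.Quotient.mk (Ideal.span (Set.range (adaptedForm b l))) (adaptedEquiv s hs l g)
        ∈ (⊤ : Submodule (MvPolynomial (Fin 4) K) _) := trivial
    rw [← adaptedForm_quotient_span_eq_top b l h2 hb0 hb1 hl,
      Submodule.mem_span_range_iff_exists_fun] at hg
    obtain ⟨c, hc⟩ := hg
    simp only [base_smul_mk] at hc
    rw [← map_sum] at hc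
    refine ⟨c, ?_⟩
    rw [mem_span_scaledForm_iff s hs b l, map_sub, map_sum]
    have := Ideal.Quotient.eq.mp hc.symm
    simpa [AlgEquiv.apply_symm_apply] using this
  independent c hc := by
    rw [mem_span_scaledForm_iff s hs b l, map_sum] at hc
    refine eq_zero_of_sum_rename_mul_prod c
      (eq_zero_of_mem_restrictSupport_of_mem_span Sum.inl_injective (isHomogeneous_adaptedForm b l)
        (adaptedForm_squarefreeSupport_sup_span b l h2 hb0 hb1 hl)
        (sum_mem fun t _ => rename_mul_prod_mem_restrictSupport (c t) t) ?_)
    simpa [AlgEquiv.apply_symm_apply] using hc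
  one := ∅
  gen_one := by simp

theorem isRadical_span_scaledForm {K : Type*} [Field K] (s : Fin 4 → K) (hs : ∀ i, s i ≠ 0)
    (b : Fin 4 → K) (l : K) (h : (Ideal.span (Set.range (adaptedForm b l))).IsRadical) :
    (Ideal.span (Set.range (scaledForm s b))).IsRadical := by
  rintro g ⟨n, hn⟩
  rw [mem_span_scaledForm_iff s hs b l] at hn ⊢
  exact h ⟨n, by rwa [← map_pow]⟩

end

/-! ### Homogeneous ideals and the projective Nullstellensatz. -/

section

attribute [local instance] MvPolynomial.gradedAlgebra

theorem homogeneousComponent_mem_of_isHomogeneous {K σ : Type*} [Field K]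
    {J : Ideal (MvPolynomial σ K)} (hJ : J.IsHomogeneous (homogeneousSubmodule σ K))
    {g : MvPolynomial σ K} (hg : g ∈ J) (n : ℕ) : homogeneousComponent n g ∈ J := by
  have := hJ n hg
  rwa [← decomposition.decompose'_apply]

theorem isHomogeneous_span_of_isHomogeneous {K σ : Type*} [Field K] (S : Set (MvPolynomial σ K))
    (hS : ∀ f ∈ S, ∃ d : ℕ, f.IsHomogeneous d) :
    (Ideal.span S).IsHomogeneous (homogeneousSubmodule σ K) :=
  Ideal.homogeneous_span _ S fun f hf => (hS f hf).imp fun _ h => h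

/-- The projective Nullstellensatz for a homogeneous polynomial and a homogeneous radical
ideal that does not contain all variables. -/
theorem mem_of_forall_projective_zero {K : Type*} [Field K] [IsAlgClosed K] {N : ℕ}
    {J : Ideal (MvPolynomial (Fin (N + 1)) K)}
    (hJ : J.IsHomogeneous (homogeneousSubmodule (Fin (N + 1)) K)) (hr : J.IsRadical)
    {i : Fin (N + 1)} (hi : X i ∉ J) {f : MvPolynomial (Fin (N + 1)) K} {d : ℕ}
    (hf : f.IsHomogeneous d)
    (h : ∀ P : ProjSpace K N, (∀ g ∈ J, eval P.rep g = 0) → eval P.rep f = 0) : f ∈ J := by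
  have key : ∀ v : Fin (N + 1) → K, v ≠ 0 → (∀ g ∈ J, eval v g = 0) → eval v f = 0 := by
    intro v hv hvJ
    rw [← eval_rep_eq_zero_iff hf v hv]
    refine h _ fun g hg => ?_
    rw [← sum_homogeneousComponent g, map_sum]
    refine Finset.sum_eq_zero fun n _ => ?_
    rw [eval_rep_eq_zero_iff (homogeneousComponent_isHomogeneous n g) v hv]
    exact hvJ _ (homogeneousComponent_mem_of_isHomogeneous hJ hg n)
  have hN : ∀ g : MvPolynomial (Fin (N + 1)) K,
      (∀ v : Fin (N + 1) → K, (∀ g ∈ J, eval v g = 0) → eval v g = 0) → g ∈ J := by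
    intro g hg
    rw [← hr.radical, ← vanishingIdeal_zeroLocus_eq_radical (K := K)]
    intro v hv
    rw [aeval_eq_eval]
    refine hg v fun g' hg' => ?_
    have := hv g' hg'
    rwa [aeval_eq_eval] at this
  -- If the affine cone were only the origin, every variable would vanish on it and lie in the
  -- radical ideal `J`. The point `w` is what settles the case of constant `f`.
  obtain ⟨w, hw, hw0⟩ : ∃ w : Fin (N + 1) → K, (∀ g ∈ J, eval w g = 0) ∧ w ≠ 0 := by
    by_contra hcon
    push Not at hcon
    refine hi (hN _ fun v hv => ?_)
    rw [hcon v hv]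
    simp
  refine hN f fun v hv => ?_
  by_cases hv0 : v = 0
  · rcases Nat.eq_zero_or_pos d with rfl | hd
    · obtain ⟨a, rfl⟩ : ∃ a, f = C a := ⟨_, totalDegree_eq_zero_iff_eq_C.mp
        (Nat.le_zero.mp hf.totalDegree_le)⟩
      have := key w hw0 hw
      simpa using this
    · rw [hv0]
      have : constantCoeff f = 0 := hf.coeff_eq_zero (by simpa using hd.ne)
      rw [constantCoeff_eq] at this
      rw [← this, eval_zero, constantCoeff_eq]
  · exact key v hv0 hv

theorem projVanishingIdeal_le {K : Type*} [Field K] [IsAlgClosed K] {N : ℕ}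
    {J : Ideal (MvPolynomial (Fin (N + 1)) K)}
    (hJ : J.IsHomogeneous (homogeneousSubmodule (Fin (N + 1)) K)) (hr : J.IsRadical)
    {i : Fin (N + 1)} (hi : X i ∉ J) {V : Set (ProjSpace K N)}
    (hV : ∀ P : ProjSpace K N, (∀ g ∈ J, eval P.rep g = 0) → P ∈ V) :
    projVanishingIdeal V ≤ J := by
  rw [projVanishingIdeal, Ideal.span_le]
  rintro f ⟨⟨d, hd⟩, hf⟩
  exact mem_of_forall_projective_zero hJ hr hi hd fun P hP => hf P (hV P hP)

theorem eval_rep_eq_zero_of_mem_projVanishingIdeal {K : Type*} [Field K] {N : ℕ}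
    {V : Set (ProjSpace K N)} {P : ProjSpace K N} (hP : P ∈ V)
    {g : MvPolynomial (Fin (N + 1)) K} (hg : g ∈ projVanishingIdeal V) : eval P.rep g = 0 := by
  have : projVanishingIdeal V ≤ RingHom.ker (eval P.rep) := by
    rw [projVanishingIdeal, Ideal.span_le]
    exact fun f hf => hf.2 P hP
  exact this hg

theorem mem_projZeroLocus_iff_forall_mem_span {K : Type*} [Field K] {N : ℕ}
    {S : Set (MvPolynomial (Fin (N + 1)) K)} {P : ProjSpace K N} :
    P ∈ projZeroLocus S ↔ ∀ g ∈ Ideal.span S, eval P.rep g = 0 := by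
  refine ⟨fun h => ?_, fun h f hf => h f (Ideal.subset_span hf)⟩
  have : Ideal.span S ≤ RingHom.ker (eval P.rep) := by
    rw [Ideal.span_le]
    exact fun f hf => h f hf
  exact fun g hg => this hg

theorem projVanishingIdeal_projZeroLocus {K : Type*} [Field K] [IsAlgClosed K] {N : ℕ}
    {S : Set (MvPolynomial (Fin (N + 1)) K)} (hS : ∀ f ∈ S, ∃ d : ℕ, f.IsHomogeneous d)
    (hr : (Ideal.span S).IsRadical) {i : Fin (N + 1)} (hi : X i ∉ Ideal.span S) :
    projVanishingIdeal (projZeroLocus S) = Ideal.span S := by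
  refine le_antisymm (projVanishingIdeal_le (isHomogeneous_span_of_isHomogeneous S hS) hr hi
    fun P hP => mem_projZeroLocus_iff_forall_mem_span.mpr hP) (Ideal.span_mono fun f hf =>
    ⟨hS f hf, fun P hP => hP f hf⟩)

end

/-! ### The Hilbert function and the degree. -/

theorem mem_span_range_X_of_isHomogeneous {K : Type*} [Field K] {N d : ℕ} (hd : d ≠ 0)
    {f : MvPolynomial (Fin N) K} (hf : f.IsHomogeneous d) :
    f ∈ Ideal.span (Set.range (X : Fin N → MvPolynomial (Fin N) K)) := by
  rw [← Set.image_univ, mem_ideal_span_X_image]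
  intro m hm
  by_contra! hcon
  have h0 : m = 0 := Finsupp.ext fun i => hcon i trivial
  subst h0
  exact (mem_support_iff.mp hm) (hf.coeff_eq_zero (by simpa using hd.symm))

namespace GradedNoetherNormalization

variable {K : Type*} [Field K] {N r : ℕ} {I : Ideal (MvPolynomial (Fin N) K)} {κ : Type*}
  [Fintype κ]

theorem eq_zero_of_param_mem (G : GradedNoetherNormalization r I κ) {p : MvPolynomial (Fin r) K}
    (hp : G.param p ∈ I) : p = 0 := by
  classical
  have := G.independent (Pi.single G.one p) (by
    rw [Finset.sum_eq_single G.one (fun t _ ht => by rw [Pi.single_eq_of_ne ht, map_zero, zero_mul])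
      (by simp), Pi.single_eq_same, G.gen_one, mul_one]
    exact hp)
  simpa using congrFun this G.one

theorem exists_X_notMem (G : GradedNoetherNormalization r I κ) (j : Fin r)
    {J : Ideal (MvPolynomial (Fin N) K)} (hJ : G.param (X j) ∉ J) : ∃ i, X i ∉ J := by
  by_contra! hcon
  refine hJ ?_
  have : Ideal.span (Set.range (X : Fin N → MvPolynomial (Fin N) K)) ≤ J := by
    rw [Ideal.span_le]
    rintro _ ⟨i, rfl⟩
    exact hcon i
  exact this (mem_span_range_X_of_isHomogeneous one_ne_zero (G.param_homogeneous j))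

theorem isHomogeneous_param (G : GradedNoetherNormalization r I κ) {p : MvPolynomial (Fin r) K}
    {d : ℕ} (hp : p.IsHomogeneous d) : (G.param p).IsHomogeneous d := by
  have h : G.param = aeval fun j => G.param (X j) := algHom_ext fun j => by simp
  rw [h]
  simpa using hp.aeval (fun j => G.param (X j)) G.param_homogeneous

theorem homogeneousComponent_param_mul_gen (G : GradedNoetherNormalization r I κ) (t : κ) {n : ℕ}
    (hn : G.deg t ≤ n) (p : MvPolynomial (Fin r) K) :
    homogeneousComponent n (G.param p * G.gen t) =
      G.param (homogeneousComponent (n - G.deg t) p) * G.gen t := by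
  induction p using MvPolynomial.induction_on' with
  | monomial m a =>
    have hm := isHomogeneous_monomial (R := K) (n := m.degree) a rfl
    rw [homogeneousComponent_of_mem ((G.isHomogeneous_param hm).mul (G.gen_homogeneous t)),
      homogeneousComponent_of_mem hm]
    by_cases h : n = m.degree + G.deg t
    · rw [if_pos h, if_pos (by omega)]
    · rw [if_neg h, if_neg (by omega), map_zero, zero_mul]
  | add p q hp hq => simp only [map_add, add_mul, hp, hq]

/-- The combination of the generators with given coefficients. -/
noncomputable def combination (G : GradedNoetherNormalization r I κ) (n : ℕ)
    (hn : ∀ t, G.deg t ≤ n) : (∀ t, homogeneousSubmodule (Fin r) K (n - G.deg t)) →ₗ[K]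
      homogeneousSubmodule (Fin N) K n where
  toFun c := ⟨∑ t, G.param (c t) * G.gen t, sum_mem fun t _ => by
    have := (G.isHomogeneous_param (c t).2).mul (G.gen_homogeneous t)
    rwa [Nat.sub_add_cancel (hn t)] at this⟩
  map_add' c d := by
    ext1
    simp [add_mul, Finset.sum_add_distrib]
  map_smul' a c := by
    ext1
    simp [Finset.smul_sum]

/-- A graded free module splits in each degree into shifted copies of the polynomial ring. The bound
on `n` keeps the truncated subtraction `n - G.deg t` honest. -/
theorem finrank_homogeneousSubmodule_quotient (G : GradedNoetherNormalization r I κ)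
    (hI : ∀ g ∈ I, ∀ n, homogeneousComponent n g ∈ I) (n : ℕ) (hn : ∀ t, G.deg t ≤ n) :
    Module.finrank K (homogeneousSubmodule (Fin N) K n ⧸
      (I.restrictScalars K).submoduleOf (homogeneousSubmodule (Fin N) K n)) =
      ∑ t, Module.finrank K (homogeneousSubmodule (Fin r) K (n - G.deg t)) := by
  have hfin : ∀ t, Module.Finite K (homogeneousSubmodule (Fin r) K (n - G.deg t)) := fun t =>
    Module.Finite.iff_fg.mpr (homogeneousSubmodule_fg (Fin r) K (n - G.deg t))
  rw [← Module.finrank_pi_fintype]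
  symm
  refine LinearEquiv.finrank_eq (LinearEquiv.ofBijective
    ((Submodule.mkQ ((I.restrictScalars K).submoduleOf (homogeneousSubmodule (Fin N) K n))).comp
      (G.combination n hn)) ⟨?_, ?_⟩)
  · rw [← LinearMap.ker_eq_bot, LinearMap.ker_eq_bot']
    intro c hc
    rw [LinearMap.comp_apply, Submodule.mkQ_apply, Submodule.Quotient.mk_eq_zero] at hc
    have := G.independent (fun t => (c t : MvPolynomial (Fin r) K)) hc
    exact funext fun t => Subtype.ext (congrFun this t)
  · intro x
    obtain ⟨⟨g, hg⟩, rfl⟩ := Submodule.mkQ_surjective _ x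
    obtain ⟨c, hc⟩ := G.span g
    refine ⟨fun t => ⟨homogeneousComponent (n - G.deg t) (c t), homogeneousComponent_mem _ _⟩, ?_⟩
    rw [LinearMap.comp_apply, ← sub_eq_zero, ← map_sub, Submodule.mkQ_apply,
      Submodule.Quotient.mk_eq_zero, ← neg_mem_iff]
    have := hI _ hc n
    rw [map_sub, map_sum, homogeneousComponent_eq_self hg] at this
    simp only [G.homogeneousComponent_param_mul_gen _ (hn _)] at this
    change -(_ - g) ∈ I
    rwa [neg_sub]

end GradedNoetherNormalization

theorem finrank_homogeneousSubmodule {K : Type*} [Field K] (r d : ℕ) :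
    Module.finrank K (homogeneousSubmodule (Fin r) K d) = (r + d - 1).choose d := by
  have h : homogeneousSubmodule (Fin r) K d =
      restrictSupport K {m : Fin r →₀ ℕ | m.degree = d} :=
    homogeneousSubmodule_eq_finsupp_supported _ _ d
  rw [h, Module.finrank_eq_nat_card_basis (basisRestrictSupport K _)]
  have h2 : {m : Fin r →₀ ℕ | m.degree = d} =
      ((Finset.univ : Finset (Fin r)).finsuppAntidiag d : Set (Fin r →₀ ℕ)) := by
    ext m
    simp [Finset.mem_finsuppAntidiag, Finsupp.degree_eq_sum]
  rw [h2]
  have := Finset.card_finsuppAntidiag_nat_eq_choose (s := (Finset.univ : Finset (Fin r))) d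
  rw [Nat.card_coe_set_eq, Set.ncard_coe_finset, this, Finset.card_univ, Fintype.card_fin]

/-- A quotient with four parameters and the generators of an exterior algebra of rank four has
degree 16. -/
theorem hasProjDegree_of_normalization {K : Type*} [Field K] {N : ℕ} {V : Set (ProjSpace K N)}
    {I : Ideal (MvPolynomial (Fin (N + 1)) K)} (hV : projVanishingIdeal V = I)
    (G : GradedNoetherNormalization 4 I (Finset (Fin 4))) (hG : ∀ t, G.deg t = t.card)
    (hI : ∀ g ∈ I, ∀ n, homogeneousComponent n g ∈ I) : HasProjDegree V 16 := by
  subst hV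
  -- The generators have degrees `0` to `4` with multiplicities `1, 4, 6, 4, 1`. Summing the shifted
  -- counts `(t - k + 3).choose 3` gives this cubic for `t = m + 4`, and `3! * 8 / 3 = 16`.
  have hH : ∀ m : ℕ, (hilbertFun V (m + 4) : ℚ) =
      8 / 3 * ((m + 4 : ℕ) : ℚ) ^ 3 + 16 / 3 * ((m + 4 : ℕ) : ℚ) := by
    intro m
    have hc : ∀ d : ℕ, ((4 + d - 1).choose d : ℚ) = (d + 1) * (d + 2) * (d + 3) / 6 := by
      intro d
      have h1 : 4 + d - 1 = d + 3 := by omega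
      rw [h1, Nat.choose_symm_add]
      have := Nat.ascFactorial_eq_factorial_mul_choose d 3
      have h2 : (((d + 1).ascFactorial 3 : ℕ) : ℚ) = 6 * ((d + 3).choose 3 : ℕ) := by
        rw [this]
        norm_num [Nat.factorial]
      simp only [Nat.ascFactorial] at h2
      push_cast at h2
      linarith
    have : hilbertFun V (m + 4) = ∑ t : Finset (Fin 4), (4 + (m + 4 - t.card) - 1).choose
        (m + 4 - t.card) := by
      rw [hilbertFun, G.finrank_homogeneousSubmodule_quotient hI (m + 4) (fun t => by
        rw [hG]
        have := Finset.card_le_univ t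
        simp at this
        omega)]
      refine Finset.sum_congr rfl fun t _ => ?_
      rw [hG, finrank_homogeneousSubmodule]
    rw [this, ← Finset.powerset_univ,
      Finset.sum_powerset_apply_card (fun k => (4 + (m + 4 - k) - 1).choose (m + 4 - k))]
    simp only [Finset.card_univ, Fintype.card_fin, Finset.sum_range_succ, Finset.sum_range_zero]
    simp only [nsmul_eq_mul]
    push_cast
    rw [hc, hc, hc, hc, hc]
    norm_num [Nat.choose]
    ring
  have hd : (Polynomial.C (8 / 3 : ℚ) * Polynomial.X ^ 3 + Polynomial.C 0 * Polynomial.X ^ 2 +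
      Polynomial.C (16 / 3) * Polynomial.X + Polynomial.C 0).natDegree = 3 :=
    Polynomial.natDegree_cubic (by norm_num)
  refine ⟨Polynomial.C (8 / 3) * Polynomial.X ^ 3 + Polynomial.C 0 * Polynomial.X ^ 2 +
      Polynomial.C (16 / 3) * Polynomial.X + Polynomial.C 0, ?_, ?_⟩
  · filter_upwards [Filter.eventually_ge_atTop 4] with t ht
    obtain ⟨m, rfl⟩ := Nat.exists_eq_add_of_le' ht
    rw [hH]
    simp
  · rw [hd, Polynomial.leadingCoeff_cubic (by norm_num)]
    norm_num [Nat.factorial]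

/-! ### Integrality, and chains of homogeneous primes. -/

theorem isIntegral_of_span_finite {P A κ : Type*} [CommRing P] [CommRing A] [Fintype κ]
    (φ : P →+* A) (g : κ → A) (h : ∀ x, ∃ c : κ → P, x = ∑ t, φ (c t) * g t) : φ.IsIntegral := by
  let _ := φ.toAlgebra
  have : Module.Finite P A := ⟨Submodule.fg_def.mpr
    ⟨Set.range g, Set.finite_range g, by
      rw [eq_top_iff]
      rintro x -
      obtain ⟨c, rfl⟩ := h x
      exact sum_mem fun t _ => Submodule.smul_mem _ (c t) (Submodule.subset_span ⟨t, rfl⟩)⟩⟩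
  exact Algebra.IsIntegral.of_finite P A |>.isIntegral

namespace GradedNoetherNormalization

variable {K : Type*} [Field K] {N r : ℕ} {I : Ideal (MvPolynomial (Fin N) K)} {κ : Type*}
  [Fintype κ]

theorem isIntegral_quotientMk_comp_param (G : GradedNoetherNormalization r I κ) :
    ((Ideal.Quotient.mk I).comp G.param.toRingHom).IsIntegral := by
  refine isIntegral_of_span_finite _ (fun t => Ideal.Quotient.mk I (G.gen t)) fun x => ?_
  obtain ⟨g, rfl⟩ := Ideal.Quotient.mk_surjective x
  obtain ⟨c, hc⟩ := G.span g
  refine ⟨c, ?_⟩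
  rw [Ideal.Quotient.eq.mpr hc, map_sum]
  simp only [map_mul]
  rfl

/-- Incomparability for primes over a graded Noether normalization. -/
theorem comap_param_lt_comap_param (G : GradedNoetherNormalization r I κ)
    {Q Q' : Ideal (MvPolynomial (Fin N) K)} [Q.IsPrime] (hI : I ≤ Q) (h : Q < Q') :
    Q.comap G.param.toRingHom < Q'.comap G.param.toRingHom := by
  obtain ⟨x, hx', hx⟩ := SetLike.exists_of_lt h
  obtain ⟨p, hp, hpx⟩ := G.isIntegral_quotientMk_comp_param (Ideal.Quotient.mk I x)
  refine Ideal.comap_lt_comap_of_root_mem_sdiff h.le ⟨hx', hx⟩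
    (Polynomial.map_monic_ne_zero hp) (hI ?_)
  rwa [← Polynomial.hom_eval₂, Ideal.Quotient.eq_zero_iff_mem] at hpx

/-- Going up for a graded Noether normalization. -/
theorem exists_ideal_over_prime (G : GradedNoetherNormalization r I κ)
    (p : Ideal (MvPolynomial (Fin r) K)) [p.IsPrime] (J : Ideal (MvPolynomial (Fin N) K))
    (hI : I ≤ J) (hJ : J.comap G.param.toRingHom ≤ p) :
    ∃ Q ≥ J, Q.IsPrime ∧ Q.comap G.param.toRingHom = p := by
  let _ := ((Ideal.Quotient.mk I).comp G.param.toRingHom).toAlgebra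
  have : Algebra.IsIntegral (MvPolynomial (Fin r) K) (MvPolynomial (Fin N) K ⧸ I) :=
    ⟨G.isIntegral_quotientMk_comp_param⟩
  have hJ' : (J.map (Ideal.Quotient.mk I)).comap (Ideal.Quotient.mk I) = J := by
    rw [Ideal.comap_map_of_surjective _ Ideal.Quotient.mk_surjective, ← RingHom.ker_eq_comap_bot,
      Ideal.mk_ker, sup_eq_left]
    exact hI
  obtain ⟨Q, hQ, hQp, hQc⟩ := Ideal.exists_ideal_over_prime_of_isIntegral p
    (J.map (Ideal.Quotient.mk I)) (by
      change ((J.map (Ideal.Quotient.mk I)).comap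
        ((Ideal.Quotient.mk I).comp G.param.toRingHom)) ≤ p
      rwa [← Ideal.comap_comap, hJ'])
  refine ⟨Q.comap (Ideal.Quotient.mk I), ?_, inferInstance, ?_⟩
  · rw [ge_iff_le, ← hJ']
    exact Ideal.comap_mono hQ
  · rw [Ideal.comap_comap]
    exact hQc

end GradedNoetherNormalization

/-- The ideal generated by the first variables, as a kernel. -/
noncomputable def initialVarsIdeal (K : Type*) [Field K] (r k : ℕ) : Ideal (MvPolynomial (Fin r) K) :=
  RingHom.ker (aeval fun j : Fin r => if (j : ℕ) < k then (0 : MvPolynomial (Fin r) K) else X j)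

instance {K : Type*} [Field K] (r k : ℕ) : (initialVarsIdeal K r k).IsPrime :=
  RingHom.ker_isPrime _

theorem X_mem_initialVarsIdeal {K : Type*} [Field K] {r k : ℕ} (j : Fin r) :
    X j ∈ initialVarsIdeal K r k ↔ (j : ℕ) < k := by
  rw [initialVarsIdeal, RingHom.mem_ker, aeval_X]
  split_ifs with h <;> simp [h]

theorem initialVarsIdeal_mono {K : Type*} [Field K] {r k : ℕ} :
    initialVarsIdeal K r k ≤ initialVarsIdeal K r (k + 1) := by
  intro p hp
  rw [initialVarsIdeal, RingHom.mem_ker] at hp ⊢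
  have h : (aeval fun j : Fin r => if (j : ℕ) < k + 1 then (0 : MvPolynomial (Fin r) K) else X j) =
      (aeval fun j : Fin r => if (j : ℕ) < k + 1 then (0 : MvPolynomial (Fin r) K) else X j).comp
      (aeval fun j : Fin r => if (j : ℕ) < k then (0 : MvPolynomial (Fin r) K) else X j) := by
    refine algHom_ext fun j => ?_
    rw [AlgHom.comp_apply, aeval_X, aeval_X]
    split_ifs with h1 h2 h2
    · rw [map_zero]
    · rw [aeval_X, if_pos h1]
    · omega
    · rw [aeval_X, if_neg h1]
  rw [h, AlgHom.comp_apply, hp, map_zero]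

section

attribute [local instance] MvPolynomial.gradedAlgebra

namespace GradedNoetherNormalization

variable {K : Type*} [Field K] {N r : ℕ} {I : Ideal (MvPolynomial (Fin N) K)} {κ : Type*}
  [Fintype κ]

/-- A homogeneous prime over the quotient that contains the first `k` parameters and no
polynomial in the remaining ones. -/
structure IsInitialPrime (G : GradedNoetherNormalization r I κ) (k : ℕ)
    (q : Ideal (MvPolynomial (Fin N) K)) : Prop where
  isPrime : q.IsPrime
  isHomogeneous : q.IsHomogeneous (homogeneousSubmodule (Fin N) K)
  le : I ≤ q
  comap_le : q.comap G.param.toRingHom ≤ initialVarsIdeal K r k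
  mem : ∀ j : Fin r, (j : ℕ) < k → G.param (X j) ∈ q

theorem exists_isInitialPrime_of_le (G : GradedNoetherNormalization r I κ) (k : ℕ)
    (J : Ideal (MvPolynomial (Fin N) K)) (hJ : J.IsHomogeneous (homogeneousSubmodule (Fin N) K))
    (hI : I ≤ J) (hc : J.comap G.param.toRingHom ≤ initialVarsIdeal K r k) :
    ∃ q ≥ J, G.IsInitialPrime k q := by
  obtain ⟨Q, hQ, hQp, hQc⟩ := G.exists_ideal_over_prime (initialVarsIdeal K r k) J hI hc
  -- The prime given by going up need not be homogeneous. Its homogeneous core is still prime,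
  -- contains `J` and the homogeneous elements `G.param (X j)` for `j < k`, and has no larger
  -- contraction; this is why `IsInitialPrime` asks for `comap_le` only.
  have hle := Ideal.toIdeal_homogeneousCore_le (homogeneousSubmodule (Fin N) K) Q
  have hJQ : J ≤ (Q.homogeneousCore (homogeneousSubmodule (Fin N) K)).toIdeal := by
    rw [← hJ.toIdeal_homogeneousCore_eq_self]
    exact Ideal.homogeneousCore_mono _ hQ
  refine ⟨_, hJQ, hQp.homogeneousCore, HomogeneousIdeal.isHomogeneous _, hI.trans hJQ,
    (Ideal.comap_mono hle).trans hQc.le, fun j hj => ?_⟩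
  refine Ideal.mem_homogeneousCore_of_homogeneous_of_mem ⟨1, G.param_homogeneous j⟩ ?_
  have : X j ∈ Q.comap G.param.toRingHom := by
    rw [hQc]
    exact (X_mem_initialVarsIdeal j).mpr hj
  exact this

theorem exists_chain_isInitialPrime (G : GradedNoetherNormalization r I κ)
    (hI : I.IsHomogeneous (homogeneousSubmodule (Fin N) K)) :
    ∃ q : ℕ → Ideal (MvPolynomial (Fin N) K), (∀ k, G.IsInitialPrime k (q k)) ∧
      ∀ k, q k ≤ q (k + 1) := by
  obtain ⟨q0, -, hq0⟩ := G.exists_isInitialPrime_of_le 0 I hI le_rfl (by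
    intro p hp
    rw [G.eq_zero_of_param_mem hp]
    exact zero_mem _)
  have step : ∀ k, ∀ q : {q // G.IsInitialPrime k q}, ∃ q' : {q // G.IsInitialPrime (k + 1) q},
      q.1 ≤ q'.1 := by
    rintro k ⟨q, hq⟩
    obtain ⟨q', hle, hq'⟩ := G.exists_isInitialPrime_of_le (k + 1) q hq.isHomogeneous hq.le
      (hq.comap_le.trans initialVarsIdeal_mono)
    exact ⟨⟨q', hq'⟩, hle⟩
  choose next hnext using step
  let s : ∀ k, {q // G.IsInitialPrime k q} := fun k => Nat.rec ⟨q0, hq0⟩ next k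
  exact ⟨fun k => (s k).1, fun k => (s k).2, fun k => hnext k (s k)⟩

theorem IsInitialPrime.param_X_notMem {G : GradedNoetherNormalization r I κ} {k : ℕ}
    {q : Ideal (MvPolynomial (Fin N) K)} (hq : G.IsInitialPrime k q) (j : Fin r) (hj : k ≤ j) :
    G.param (X j) ∉ q := fun h =>
  absurd ((X_mem_initialVarsIdeal j).mp (hq.comap_le h)) (by omega)

end GradedNoetherNormalization

end

/-! ### The dimension in the Zariski topology. -/

section

attribute [local instance] MvPolynomial.gradedAlgebra zariskiTopology

theorem isClosed_zariski_iff {K : Type*} [Field K] {N : ℕ} {Z : Set (ProjSpace K N)} :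
    IsClosed Z ↔ ∃ S : Set (MvPolynomial (Fin (N + 1)) K),
      (∀ f ∈ S, ∃ d : ℕ, f.IsHomogeneous d) ∧ Z = projZeroLocus S := by
  rw [← isOpen_compl_iff]
  change Zᶜᶜ ∈ _ ↔ _
  rw [compl_compl]
  rfl

variable {K : Type*} [Field K] {N : ℕ} {V : Set (ProjSpace K N)}

theorem isHomogeneous_projVanishingIdeal (V : Set (ProjSpace K N)) :
    (projVanishingIdeal V).IsHomogeneous (homogeneousSubmodule (Fin (N + 1)) K) :=
  isHomogeneous_span_of_isHomogeneous _ fun _ hf => hf.1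

theorem mem_projVanishingIdeal_iff {f : MvPolynomial (Fin (N + 1)) K} {d : ℕ}
    (hf : f.IsHomogeneous d) : f ∈ projVanishingIdeal V ↔ ∀ P ∈ V, eval P.rep f = 0 :=
  ⟨fun h _ hP => eval_rep_eq_zero_of_mem_projVanishingIdeal hP h,
    fun h => Ideal.subset_span ⟨⟨d, hf⟩, h⟩⟩

theorem projVanishingIdeal_anti {V W : Set (ProjSpace K N)} (h : V ⊆ W) :
    projVanishingIdeal W ≤ projVanishingIdeal V :=
  Ideal.span_mono fun _ hf => ⟨hf.1, fun P hP => hf.2 P (h hP)⟩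

theorem isClosed_setOf_eval_eq_zero {f : MvPolynomial (Fin (N + 1)) K} {d : ℕ}
    (hf : f.IsHomogeneous d) : IsClosed {P : V | eval P.1.rep f = 0} := by
  refine isClosed_induced_iff.mpr ⟨projZeroLocus {f}, isClosed_zariski_iff.mpr
    ⟨{f}, ?_, rfl⟩, ?_⟩
  · rintro _ rfl
    exact ⟨d, hf⟩
  · ext P
    simp [projZeroLocus]

theorem isPrime_projVanishingIdeal {Z : Set V} (hZ : IsIrreducible Z) :
    (projVanishingIdeal (Subtype.val '' Z)).IsPrime := by
  obtain ⟨⟨P, hP⟩, hZ⟩ := hZ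
  refine (isHomogeneous_projVanishingIdeal _).isPrime_of_homogeneous_mem_or_mem ?_ ?_
  · rw [Ne, Ideal.eq_top_iff_one]
    intro h
    simpa using eval_rep_eq_zero_of_mem_projVanishingIdeal (Set.mem_image_of_mem _ hP) h
  · rintro f g ⟨d, hf⟩ ⟨e, hg⟩ hfg
    refine ((isPreirreducible_iff_isClosed_union_isClosed.mp hZ) _ _
      (isClosed_setOf_eval_eq_zero hf) (isClosed_setOf_eval_eq_zero hg) ?_).imp ?_ ?_
    · intro Q hQ
      have := eval_rep_eq_zero_of_mem_projVanishingIdeal (Set.mem_image_of_mem _ hQ) hfg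
      rw [map_mul] at this
      exact mul_eq_zero.mp this
    · intro h
      rw [mem_projVanishingIdeal_iff hf]
      rintro _ ⟨Q, hQ, rfl⟩
      exact h hQ
    · intro h
      rw [mem_projVanishingIdeal_iff hg]
      rintro _ ⟨Q, hQ, rfl⟩
      exact h hQ

theorem projVanishingIdeal_lt {Z Z' : Set V} (hc : IsClosed Z) (h : Z ⊂ Z') :
    projVanishingIdeal (Subtype.val '' Z') < projVanishingIdeal (Subtype.val '' Z) := by
  refine lt_of_le_of_ne (projVanishingIdeal_anti (Set.image_mono h.1)) fun heq => h.2 ?_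
  obtain ⟨T, hT, rfl⟩ := isClosed_induced_iff.mp hc
  obtain ⟨S, hS, rfl⟩ := isClosed_zariski_iff.mp hT
  intro P hP f hf
  have : f ∈ projVanishingIdeal (Subtype.val '' ((Subtype.val : V → _) ⁻¹' projZeroLocus S)) := by
    refine Ideal.subset_span ⟨hS f hf, ?_⟩
    rintro _ ⟨Q, hQ, rfl⟩
    exact hQ f hf
  rw [← heq] at this
  exact eval_rep_eq_zero_of_mem_projVanishingIdeal (Set.mem_image_of_mem _ hP) this

/-- The irrelevant ideal lies strictly above the ideal of every nonempty set; it provides the extra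
step between projective and affine dimension. -/
theorem projVanishingIdeal_lt_ker_eval_zero {A : Set (ProjSpace K N)} (hA : A.Nonempty) :
    projVanishingIdeal A < RingHom.ker (eval (0 : Fin (N + 1) → K)) := by
  obtain ⟨P, hP⟩ := hA
  refine lt_of_le_of_ne ?_ fun heq => ?_
  · rw [projVanishingIdeal, Ideal.span_le]
    rintro f ⟨⟨d, hd⟩, hf⟩
    rw [SetLike.mem_coe, RingHom.mem_ker, eval_zero]
    rcases Nat.eq_zero_or_pos d with rfl | h
    · obtain ⟨a, rfl⟩ : ∃ a, f = C a := ⟨_, totalDegree_eq_zero_iff_eq_C.mp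
        (Nat.le_zero.mp hd.totalDegree_le)⟩
      simpa using hf P hP
    · rw [constantCoeff_eq]
      exact hd.coeff_eq_zero (by simpa using h.ne)
  · refine P.rep_nonzero (funext fun i => ?_)
    have : X i ∈ projVanishingIdeal A := by
      rw [heq, RingHom.mem_ker, eval_X, Pi.zero_apply]
    simpa using eval_rep_eq_zero_of_mem_projVanishingIdeal hP this

/-- Chains of irreducible closed sets give reversed chains of primes, which stay strict after
contraction to the polynomial ring by incomparability. Adjoining the irrelevant ideal lengthens each
chain by one, and the polynomial ring has dimension `r + 1`. -/
theorem projDim_le {r : ℕ} {κ : Type*} [Fintype κ]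
    (G : GradedNoetherNormalization (r + 1) (projVanishingIdeal V) κ) : projDim V ≤ r := by
  change Order.krullDim (TopologicalSpace.IrreducibleCloseds V) ≤ r
  have hle : ∀ Z : Set V, projVanishingIdeal V ≤ projVanishingIdeal (Subtype.val '' Z) := fun Z =>
    projVanishingIdeal_anti (by rintro _ ⟨P, -, rfl⟩; exact P.2)
  let f : TopologicalSpace.IrreducibleCloseds V → PrimeSpectrum (MvPolynomial (Fin (r + 1)) K) :=
    fun Z => PrimeSpectrum.comap G.param.toRingHom
      ⟨projVanishingIdeal (Subtype.val '' (Z : Set V)), isPrime_projVanishingIdeal Z.isIrreducible⟩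
  let m : PrimeSpectrum (MvPolynomial (Fin (r + 1)) K) := PrimeSpectrum.comap G.param.toRingHom
    ⟨RingHom.ker (eval (0 : Fin (N + 1) → K)), RingHom.ker_isPrime _⟩
  have hf : StrictMono fun Z => OrderDual.toDual (f Z) := by
    intro Z Z' h
    have := isPrime_projVanishingIdeal Z'.isIrreducible
    exact G.comap_param_lt_comap_param (hle _) (projVanishingIdeal_lt Z.isClosed h)
  have hm : ∀ Z, OrderDual.toDual m < OrderDual.toDual (f Z) := by
    intro Z
    have := isPrime_projVanishingIdeal Z.isIrreducible
    exact G.comap_param_lt_comap_param (hle _)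
      (projVanishingIdeal_lt_ker_eval_zero (Z.isIrreducible.1.image _))
  refine iSup_le fun p => ?_
  -- In the dual order the irrelevant ideal is the least element, hence goes in front of the chain.
  have h := Order.LTSeries.length_le_krullDim
    ((p.map _ hf).cons (OrderDual.toDual m) (hm _))
  rw [Order.krullDim_orderDual] at h
  have hd : Order.krullDim (PrimeSpectrum (MvPolynomial (Fin (r + 1)) K)) =
      ((r + 1 : ℕ) : WithBot ℕ∞) := by
    change ringKrullDim _ = _
    rw [MvPolynomial.ringKrullDim_of_isNoetherianRing, ringKrullDim_eq_zero_of_field]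
    simp
  rw [hd] at h
  have h' : p.length + 1 ≤ r + 1 := by
    have : ((p.map _ hf).cons (OrderDual.toDual m) (hm _)).length = p.length + 1 :=
      RelSeries.cons_length (p.map _ hf) _ _
    rw [this] at h
    exact_mod_cast h
  exact_mod_cast Nat.le_of_succ_le_succ h'

/-- The zero set of an ideal in a projective variety. -/
def zeroSetIn (V : Set (ProjSpace K N)) (q : Ideal (MvPolynomial (Fin (N + 1)) K)) : Set V :=
  {P | ∀ g ∈ q, eval P.1.rep g = 0}

theorem isClosed_zeroSetIn {q : Ideal (MvPolynomial (Fin (N + 1)) K)}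
    (hq : q.IsHomogeneous (homogeneousSubmodule (Fin (N + 1)) K)) : IsClosed (zeroSetIn V q) := by
  have : zeroSetIn V q = ⋂ g ∈ q, ⋂ n : ℕ, {P : V | eval P.1.rep (homogeneousComponent n g) = 0} := by
    ext P
    simp only [zeroSetIn, Set.mem_ofPred_eq, Set.mem_iInter]
    refine ⟨fun h g hg n => h _ (homogeneousComponent_mem_of_isHomogeneous hq hg n),
      fun h g hg => ?_⟩
    rw [← sum_homogeneousComponent g, map_sum]
    exact Finset.sum_eq_zero fun n _ => h g hg n
  rw [this]
  exact isClosed_biInter fun g _ => isClosed_iInter fun n =>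
    isClosed_setOf_eval_eq_zero (homogeneousComponent_isHomogeneous n g)

section

variable [IsAlgClosed K] {q : Ideal (MvPolynomial (Fin (N + 1)) K)}

theorem mem_of_forall_mem_zeroSetIn
    (hV : ∀ P : ProjSpace K N, (∀ g ∈ projVanishingIdeal V, eval P.rep g = 0) → P ∈ V)
    (hq : q.IsHomogeneous (homogeneousSubmodule (Fin (N + 1)) K)) (hp : q.IsPrime)
    (hle : projVanishingIdeal V ≤ q) {i : Fin (N + 1)} (hi : X i ∉ q)
    {f : MvPolynomial (Fin (N + 1)) K} {d : ℕ} (hf : f.IsHomogeneous d)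
    (h : ∀ P ∈ zeroSetIn V q, eval P.1.rep f = 0) : f ∈ q :=
  mem_of_forall_projective_zero hq hp.isRadical hi hf fun P hP =>
    h ⟨P, hV P fun g hg => hP g (hle hg)⟩ hP

/-- The condition `X i ∉ q` excludes the irrelevant ideal, whose zero set would be empty. -/
theorem isIrreducible_zeroSetIn
    (hV : ∀ P : ProjSpace K N, (∀ g ∈ projVanishingIdeal V, eval P.rep g = 0) → P ∈ V)
    (hq : q.IsHomogeneous (homogeneousSubmodule (Fin (N + 1)) K)) (hp : q.IsPrime)
    (hle : projVanishingIdeal V ≤ q) {i : Fin (N + 1)} (hi : X i ∉ q) :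
    IsIrreducible (zeroSetIn V q) := by
  refine ⟨?_, isPreirreducible_iff_isClosed_union_isClosed.mpr ?_⟩
  · by_contra hcon
    rw [Set.not_nonempty_iff_eq_empty] at hcon
    refine hi (mem_of_forall_mem_zeroSetIn hV hq hp hle hi (isHomogeneous_X K i) fun P hP => ?_)
    rw [hcon] at hP
    exact hP.elim
  · intro z₁ z₂ h₁ h₂ hsub
    obtain ⟨T₁, hT₁, rfl⟩ := isClosed_induced_iff.mp h₁
    obtain ⟨S₁, hS₁, rfl⟩ := isClosed_zariski_iff.mp hT₁
    obtain ⟨T₂, hT₂, rfl⟩ := isClosed_induced_iff.mp h₂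
    obtain ⟨S₂, hS₂, rfl⟩ := isClosed_zariski_iff.mp hT₂
    by_contra! hcon
    obtain ⟨⟨P, hP, hP'⟩, ⟨Q, hQ, hQ'⟩⟩ := And.imp Set.not_subset.mp Set.not_subset.mp hcon
    obtain ⟨f, hf, hfP⟩ : ∃ f ∈ S₁, eval P.1.rep f ≠ 0 := by
      by_contra! h
      exact hP' h
    obtain ⟨g, hg, hgQ⟩ : ∃ g ∈ S₂, eval Q.1.rep g ≠ 0 := by
      by_contra! h
      exact hQ' h
    obtain ⟨d, hd⟩ := hS₁ f hf
    obtain ⟨e, he⟩ := hS₂ g hg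
    have : f * g ∈ q := by
      refine mem_of_forall_mem_zeroSetIn hV hq hp hle hi (hd.mul he) fun R hR => ?_
      rw [map_mul]
      rcases hsub hR with h | h
      · rw [h f hf, zero_mul]
      · rw [h g hg, mul_zero]
    rcases hp.mem_or_mem this with h | h
    · exact hfP (hP f h)
    · exact hgQ (hQ g h)

theorem zeroSetIn_ssubset
    (hV : ∀ P : ProjSpace K N, (∀ g ∈ projVanishingIdeal V, eval P.rep g = 0) → P ∈ V)
    (hq : q.IsHomogeneous (homogeneousSubmodule (Fin (N + 1)) K)) (hp : q.IsPrime)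
    (hle : projVanishingIdeal V ≤ q) {i : Fin (N + 1)} (hi : X i ∉ q)
    {q' : Ideal (MvPolynomial (Fin (N + 1)) K)} (hqq : q ≤ q')
    {f : MvPolynomial (Fin (N + 1)) K} {d : ℕ} (hf : f.IsHomogeneous d) (hf' : f ∈ q')
    (hfq : f ∉ q) : zeroSetIn V q' ⊂ zeroSetIn V q :=
  ⟨fun _ hP g hg => hP g (hqq hg), fun h => hfq
    (mem_of_forall_mem_zeroSetIn hV hq hp hle hi hf fun _ hP => h hP f hf')⟩

/-- The zero sets of the primes `q 0 ≤ ... ≤ q r` form a strictly decreasing chain: the parameter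
with index `k` lies in `q (k + 1)` but not in `q k`. For `k ≤ r` some parameter is still missing
from `q k`, so its zero set is nonempty. -/
theorem le_projDim {r : ℕ} {κ : Type*} [Fintype κ]
    (hV : ∀ P : ProjSpace K N, (∀ g ∈ projVanishingIdeal V, eval P.rep g = 0) → P ∈ V)
    (G : GradedNoetherNormalization (r + 1) (projVanishingIdeal V) κ) : r ≤ projDim V := by
  change (r : WithBot ℕ∞) ≤ Order.krullDim (TopologicalSpace.IrreducibleCloseds V)
  obtain ⟨q, hq, hmono⟩ := G.exists_chain_isInitialPrime (isHomogeneous_projVanishingIdeal V)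
  have hX : ∀ k : Fin (r + 1), ∃ i, X i ∉ q k := fun k =>
    G.exists_X_notMem k ((hq k).param_X_notMem k le_rfl)
  have hirr : ∀ k : Fin (r + 1), IsIrreducible (zeroSetIn V (q k)) := fun k => by
    obtain ⟨i, hi⟩ := hX k
    exact isIrreducible_zeroSetIn hV (hq k).isHomogeneous (hq k).isPrime (hq k).le hi
  rw [← Order.krullDim_orderDual, Order.le_krullDim_iff]
  refine ⟨⟨r, fun k => OrderDual.toDual
    ⟨zeroSetIn V (q k), hirr k, isClosed_zeroSetIn (hq k).isHomogeneous⟩, fun k => ?_⟩, rfl⟩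
  obtain ⟨i, hi⟩ := hX k.castSucc
  exact zeroSetIn_ssubset hV (hq _).isHomogeneous (hq _).isPrime (hq _).le hi (hmono k)
    (G.param_homogeneous k.castSucc) ((hq (k + 1)).mem k.castSucc (Nat.lt_succ_self _))
    ((hq k).param_X_notMem k.castSucc le_rfl)

end

end

/-! ### The disjoint linear subspace. -/

section

variable {K : Type*} [Field K]

/-- A parametrized four-dimensional space of vectors. -/
noncomputable def skewEmbedding (s : Fin 4 → K) : (Fin 4 → K) →ₗ[K] (Fin (7 + 1) → K) where
  toFun v := ![v 0, v 1, v 2, 0, (s 0)⁻¹ * v 3, (s 1)⁻¹ * v 3, 0, 0]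
  map_add' v w := by
    ext i
    fin_cases i <;> simp [mul_add]
  map_smul' a v := by
    ext i
    fin_cases i <;> simp [mul_left_comm]

theorem skewEmbedding_injective (s : Fin 4 → K) (hs : ∀ i, s i ≠ 0) :
    Function.Injective (skewEmbedding s) := by
  rw [← LinearMap.ker_eq_bot, LinearMap.ker_eq_bot']
  intro v hv
  have h0 : v 0 = 0 := congrFun hv 0
  have h1 : v 1 = 0 := congrFun hv 1
  have h2 : v 2 = 0 := congrFun hv 2
  have h3 : (s 0)⁻¹ * v 3 = 0 := congrFun hv 4
  have h3' : v 3 = 0 := (mul_eq_zero.mp h3).resolve_left (inv_ne_zero (hs 0))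
  ext i
  fin_cases i <;> assumption

/-- On the subspace `y_0 = y_1 = v 3` and `y_2 = y_3 = 0`, so `v 2 = 0` and both `v 1` and `v 0 + v
1` square to `v 3 ^ 2`. Thus `v 0` is `0` or `-2 * v 1`, and the first equation then gives `v 3 = 0`
because `b 0` is neither `1` nor `-1`. -/
theorem eq_zero_of_eval_scaledForm_skewEmbedding (s b : Fin 4 → K) (hs : ∀ i, s i ≠ 0)
    (h2 : (2 : K) ≠ 0) (h0 : b 0 ^ 2 ≠ 1) (v : Fin 4 → K)
    (h : ∀ k, eval (skewEmbedding s v) (scaledForm s b k) = 0) : v = 0 := by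
  have e0 : v 0 ^ 2 - (v 3 ^ 2 + v 3 ^ 2 - 2 * b 0 * v 3 * v 3) = 0 := by
    simpa [scaledForm, conicForm, skewEmbedding, mul_inv_cancel_left₀ (hs _)] using h 0
  have e1 : v 1 ^ 2 - v 3 ^ 2 = 0 := by
    simpa [scaledForm, conicForm, skewEmbedding, mul_inv_cancel_left₀ (hs _)] using h 1
  have e2 : v 2 = 0 := by
    simpa [scaledForm, conicForm, skewEmbedding, mul_inv_cancel_left₀ (hs _)] using h 2
  have e3 : (v 0 + v 1 + v 2) ^ 2 - v 3 ^ 2 = 0 := by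
    simpa [scaledForm, conicForm, skewEmbedding, mul_inv_cancel_left₀ (hs _)] using h 3
  have hv : v 0 * (v 0 + 2 * v 1) = 0 := by
    rw [e2] at e3
    linear_combination e3 - e1
  have hz : (2 * (b 0 ^ 2 - 1)) * v 3 ^ 2 = 0 := by
    rcases mul_eq_zero.mp hv with hv | hv
    · rw [hv] at e0
      linear_combination (b 0 + 1) * e0
    · have hv' : v 0 = -2 * v 1 := by linear_combination hv
      rw [hv'] at e0
      linear_combination (b 0 - 1) * (e0 - 4 * e1)
  have h3 : v 3 = 0 := by
    have := (mul_eq_zero.mp hz).resolve_left (mul_ne_zero h2 (sub_ne_zero.mpr h0))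
    exact pow_eq_zero_iff two_ne_zero |>.mp this
  have h1 : v 1 = 0 := pow_eq_zero_iff two_ne_zero |>.mp (by
    rw [h3] at e1
    linear_combination e1)
  have h00 : v 0 = 0 := pow_eq_zero_iff two_ne_zero |>.mp (by
    rw [h3] at e0
    linear_combination e0)
  ext i
  fin_cases i <;> assumption

theorem exists_disjoint_submodule (s b : Fin 4 → K) (hs : ∀ i, s i ≠ 0) (h2 : (2 : K) ≠ 0)
    (h0 : b 0 ^ 2 ≠ 1) : ∃ L : Submodule K (Fin (7 + 1) → K), Module.finrank K L = 3 + 1 ∧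
      ∀ P ∈ projZeroLocus (Set.range (scaledForm s b)), ¬ P.submodule ≤ L := by
  refine ⟨LinearMap.range (skewEmbedding s), ?_, fun P hP hle => P.rep_nonzero ?_⟩
  · rw [LinearMap.finrank_range_of_inj (skewEmbedding_injective s hs)]
    simp
  · have hr : P.rep ∈ P.submodule := by
      rw [Projectivization.submodule_eq]
      exact Submodule.mem_span_singleton_self _
    obtain ⟨v, hv⟩ := hle hr
    rw [← hv, eq_zero_of_eval_scaledForm_skewEmbedding s b hs h2 h0 v
      fun k => hv ▸ hP _ ⟨k, rfl⟩, map_zero]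

/-! ### Assembly, and the hypotheses over the finite field. -/

theorem scaledForm_variety [IsAlgClosed K] (s b : Fin 4 → K) (hs : ∀ i, s i ≠ 0)
    (h2 : (2 : K) ≠ 0) (hb3 : b 3 ≠ 0) (h0 : b 0 ^ 2 ≠ 1) (h1 : b 1 ^ 2 ≠ 1) (h3 : b 3 ^ 2 ≠ 1)
    (h02 : b 3 ^ 2 = b 0 ^ 2 → b 2 = b 0) :
    projDim (projZeroLocus (Set.range (scaledForm s b))) = 3 ∧
    HasProjDegree (projZeroLocus (Set.range (scaledForm s b))) 16 ∧
    projVanishingIdeal (projZeroLocus (Set.range (scaledForm s b))) =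
      Ideal.span (Set.range (scaledForm s b)) := by
  obtain ⟨l, hl, p, x, hx, hfib⟩ := exists_fibre h2 b h0 h1 h3 h02
  have hrad := isRadical_span_scaledForm s hs b l
    (isRadical_span_adaptedForm b l h2 hb3 h3 hl p x hx hfib)
  have hhom : ∀ f ∈ Set.range (scaledForm s b), ∃ d : ℕ, f.IsHomogeneous d := by
    rintro _ ⟨k, rfl⟩
    exact ⟨2, isHomogeneous_scaledForm s b k⟩
  let G := scaledNormalization s hs b h2 hb3 h3 hl
  obtain ⟨i, hi⟩ := G.exists_X_notMem 0 fun h => X_ne_zero _ (G.eq_zero_of_param_mem h)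
  have heq := projVanishingIdeal_projZeroLocus hhom hrad hi
  refine ⟨le_antisymm (projDim_le (heq.symm ▸ G)) (le_projDim (fun P hP => ?_) (heq.symm ▸ G)),
    hasProjDegree_of_normalization heq G (fun _ => rfl) fun g hg n =>
      homogeneousComponent_mem_of_isHomogeneous (isHomogeneous_span_of_isHomogeneous _ hhom) hg n,
    heq⟩
  rw [mem_projZeroLocus_iff_forall_mem_span, ← heq]
  exact hP

theorem sub_eq_conicForm {σ : Type*} (p x y : MvPolynomial σ K) {a a' e c s t : K}
    (ha : a = s ^ 2) (ha' : a' = t ^ 2) (he : e = c * (s * t)) :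
    p ^ 2 - (C a * x ^ 2 + C a' * y ^ 2 - C e * x * y) = conicForm c p (C s * x) (C t * y) := by
  subst ha ha' he
  simp only [conicForm, C_mul, C_pow]
  ring

theorem sq_pow_half (s : K) {k : ℕ} (hk : Even k) : (s ^ 2) ^ (k / 2) = s ^ k := by
  rw [← pow_mul, Nat.two_mul_div_two_of_even hk]

/-- For odd `q` the halved exponents are exact, so `(s ^ 2) ^ ((q ^ i + q ^ j) / 2)` is the product
of the two scaling factors. -/
theorem quadricForm_eq_scaledForm {q : ℕ} (hq : Odd q) (β s : K) :
    quadricForm q β (s ^ 2) =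
      scaledForm (fun i => s ^ q ^ (i : ℕ)) (fun i => β ^ q ^ (i : ℕ)) := by
  ext1 k
  fin_cases k
  · refine sub_eq_conicForm _ _ _ (by simp) (by simp [← pow_mul, mul_comm]) ?_
    rw [sq_pow_half s (hq.add_odd odd_one)]
    simp [pow_add, mul_comm]
  · refine sub_eq_conicForm _ _ _ (by simp [← pow_mul, mul_comm]) (by simp [← pow_mul, mul_comm]) ?_
    rw [sq_pow_half s (hq.pow.add_odd hq)]
    simp [pow_add, mul_comm]
  · refine sub_eq_conicForm _ _ _ (by simp [← pow_mul, mul_comm]) (by simp [← pow_mul, mul_comm]) ?_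
    rw [sq_pow_half s (hq.pow.add_odd hq.pow)]
    simp [pow_add, mul_comm]
  · refine sub_eq_conicForm _ _ _ (by simp [← pow_mul, mul_comm]) (by simp) ?_
    rw [sq_pow_half s (odd_one.add_odd hq.pow)]
    simp [pow_add, mul_comm]

end

/-- If `β ^ q ^ i` were `1` or `-1`, raising it to the odd power `q ^ (4 - i)` would return `β`
itself as `1` or `-1`. -/
theorem pow_frobenius_sq_ne_one {F : Type*} [Field F] [Fintype F] {q : ℕ}
    (hodd : Odd q) (hF : Fintype.card F = q ^ 4) {β : F} (hβ1 : β ≠ 1) (hβ2 : β ≠ -1) {i : ℕ}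
    (hi : i ≤ 4) : (β ^ q ^ i) ^ 2 ≠ 1 := by
  intro h
  have hβ : β ^ q ^ 4 = β := hF ▸ FiniteField.pow_card β
  have hp : β = (β ^ q ^ i) ^ q ^ (4 - i) := by
    rw [← pow_mul, ← pow_add, Nat.add_sub_cancel' hi, hβ]
  rcases sq_eq_sq_iff_eq_or_eq_neg.mp (h.trans (one_pow 2).symm) with h | h
  · exact hβ1 (by rw [hp, h, one_pow])
  · exact hβ2 (by rw [hp, h, hodd.pow.neg_one_pow])

/-- If `β ^ q ^ 3` is `β` or `-β`, one more `q`-th power, which gives `β`, shows that `β ^ q` is `β`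
or `-β`; in both cases a second `q`-th power returns `β`. This is the condition `b 2 = b 0` required
when `b 3 ^ 2 = b 0 ^ 2`. -/
theorem pow_frobenius_two_eq {F : Type*} [Field F] [Fintype F] {q : ℕ}
    (hodd : Odd q) (hF : Fintype.card F = q ^ 4) {β : F} (h : (β ^ q ^ 3) ^ 2 = β ^ 2) :
    β ^ q ^ 2 = β := by
  have hβ : β ^ q ^ 4 = β := hF ▸ FiniteField.pow_card β
  have h4 : (β ^ q ^ 3) ^ q = β := by rw [← pow_mul, ← pow_succ, hβ]
  rcases sq_eq_sq_iff_eq_or_eq_neg.mp h with h | h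
  · rw [h] at h4
    rw [pow_two, pow_mul, h4, h4]
  · rw [h, hodd.neg_pow] at h4
    have h5 : β ^ q = -β := by rw [← h4, neg_neg, h4]
    rw [pow_two, pow_mul, h5, hodd.neg_pow, h5, neg_neg]

theorem mainTheorem5 (q : ℕ) (hq : IsPrimePow q) (hodd : Odd q)
    {F : Type*} [Field F] [Fintype F] (hF : Fintype.card F = q ^ 4)
    {K : Type*} [Field K] [Algebra F K] [IsAlgClosure F K]
    (β η : F) (hβ0 : β ≠ 0) (hβ1 : β ≠ 1) (hβ2 : β ≠ -1) (hη : ¬ IsSquare η) :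
    projDim (varietyV q (algebraMap F K β) (algebraMap F K η)) = 3 ∧
    HasProjDegree (varietyV q (algebraMap F K β) (algebraMap F K η)) 16 ∧
    (∃ L : Submodule K (Fin (7 + 1) → K), Module.finrank K L = 3 + 1 ∧
      ∀ P ∈ varietyV q (algebraMap F K β) (algebraMap F K η), ¬ P.submodule ≤ L) ∧
    projVanishingIdeal (varietyV q (algebraMap F K β) (algebraMap F K η)) =
      Ideal.span (Set.range (quadricForm q (algebraMap F K β) (algebraMap F K η))) := by
  have : IsAlgClosed K := IsAlgClosure.isAlgClosed F
  have hinj : Function.Injective (algebraMap F K) := (algebraMap F K).injective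
  have h2F : (2 : F) ≠ 0 := Ring.two_ne_zero fun h => by
    have := FiniteField.even_card_of_char_two h
    rw [hF] at this
    have h4 : Odd (q ^ 4) := hodd.pow
    rw [Nat.odd_iff] at h4
    omega
  have h2 : (2 : K) ≠ 0 := by
    rw [← map_ofNat (algebraMap F K) 2]
    exact (map_ne_zero _).mpr h2F
  have hη0 : η ≠ 0 := by
    rintro rfl
    exact hη IsSquare.zero
  obtain ⟨s, hs⟩ := IsAlgClosed.exists_pow_nat_eq (algebraMap F K η) two_pos
  have hs0 : s ≠ 0 := by
    rintro rfl
    rw [zero_pow two_ne_zero] at hs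
    exact (map_ne_zero (algebraMap F K)).mpr hη0 hs.symm
  have hsq : ∀ i ≤ 4, (algebraMap F K β ^ q ^ i) ^ 2 ≠ 1 := fun i hi h => by
    rw [← map_pow, ← map_pow, ← map_one (algebraMap F K)] at h
    exact pow_frobenius_sq_ne_one hodd hF hβ1 hβ2 hi (hinj h)
  rw [varietyV, ← hs, quadricForm_eq_scaledForm hodd]
  obtain ⟨hdim, hdeg, hideal⟩ := scaledForm_variety (fun i : Fin 4 => s ^ q ^ (i : ℕ))
    (fun i : Fin 4 => algebraMap F K β ^ q ^ (i : ℕ)) (fun i => pow_ne_zero _ hs0) h2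
    (pow_ne_zero _ ((map_ne_zero _).mpr hβ0)) (hsq 0 (by norm_num)) (hsq 1 (by norm_num))
    (hsq 3 (by norm_num)) (fun h => by
      have h' : (β ^ q ^ 3) ^ 2 = β ^ 2 := hinj (by simpa using h)
      have := congrArg (algebraMap F K) (pow_frobenius_two_eq hodd hF h')
      simpa using this)
  exact ⟨hdim, hdeg, exists_disjoint_submodule _ _ (fun i => pow_ne_zero _ hs0) h2
    (hsq 0 (by norm_num)), hideal⟩
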